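/- Identify a partition with its Young diagram. Let $R$ be a ribbon, that is, a skew shape without a $2\times 2$ block of boxes, not necessarily connected, whose row lengths from top to bottom form a partition $\alpha=(\alpha_1\ge\dots\ge\alpha_\ell)$ with all parts $\ge 2$. Its overlapping partition is $p=(p_1,\dots,p_{\ell-1},0)$, where $p_i$ is the number of columns of length two in the diagram formed by the last $\ell-i+1$ rows of $R$; write $R=R_\alpha^p$ and let $\ell(p)$ be the number of nonzero $p_i$. The support $[R_\alpha^p]$ is the set of partitions $\nu$ such that the Schur function $s_\nu$ has a nonzero coefficient in the expansion of the skew Schur function $s_{R_\alpha^p}$ in the basis of Schur functions. The Schur interval of $R_\alpha^p$ is the interval $[\alpha,(|\alpha|-p_1,p_1)]$ in the dominance order on partitions of $|\alpha|$. For $1\le i\le \ell(p)-1$ put $$\varrho_i:=1+\sum_{q=i+1}^{\ell}\alpha_q-p_{i+1},\qquad \tilde g^i_j:=[\varrho_i-\alpha_j]_+=\max\{0,\varrho_i-\alpha_j\}\ (1\le j\le i),\qquad |\tilde g^i|:=\sum_{j=1}^i\tilde g^i_j .$$ **Theorem 1.3.** $[R_\alpha^p]\subsetneqq[\alpha,(|\alpha|-p_1,p_1)]$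 if and only if $\ell(p)\ge 2$ and, for some $1\le i\le \ell(p)-1$, $$\sum_{j=1}^i[\varrho_i-\alpha_j]_+\le p_{i+1}-1.$$ Moreover, for every $1\le i\le\ell(p)-1$ satisfying this inequality, $\alpha_j+\tilde g^i_j\ge\varrho_i\ge p_{i+1}-1-|\tilde g^i|$ for $j=1,\dots,i$, and the decreasing rearrangement of $$(\alpha_1+\tilde g^i_1,\ \dots,\ \alpha_i+\tilde g^i_i,\ \varrho_i,\ p_{i+1}-1-|\tilde g^i|)$$ (zero entries omitted) is a partition of $|\alpha|$ that lies in the Schur interval of $R_\alpha^p$ but not in its support. -/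

import Mathlib

/-! Partitions are identified with their Young diagrams (Mathlib's `YoungDiagram`): the `i`-th part of
`ν`, counted from `0`, is `ν.rowLen i`, its length is `ν.colLen 0` and its size is `ν.card`. -/

namespace MonotoneRibbon

/-- The partition obtained by arranging the positive members of a multiset in decreasing order. -/
def decreasingRearrangement (s : Multiset ℕ) : YoungDiagram :=
  YoungDiagram.ofRowLens (s.sort (· ≥ ·)) (Multiset.pairwise_sort s (· ≥ ·)).sortedGE

/-- The dominance order on partitions: equal sizes, and the partial sums of `ν` are at most those
of `ξ`. -/
def Dominated (ν ξ : YoungDiagram) : Prop :=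
  ν.card = ξ.card ∧
    ∀ k : ℕ, ∑ i ∈ Finset.range k, ν.rowLen i ≤ ∑ i ∈ Finset.range k, ξ.rowLen i

/-- The interval `[ν, ξ]` in the dominance order. -/
def dominanceInterval (ν ξ : YoungDiagram) : Set YoungDiagram :=
  {κ | Dominated ν κ ∧ Dominated κ ξ}

/-- The boxes of the skew diagram `lam / mu`. A box `(r, c)` lies in row `r` (counted from the top)
and column `c`. -/
def skewCells (lam mu : YoungDiagram) : Finset (ℕ × ℕ) :=
  lam.cells \ mu.cells

/-- A semistandard tableau of skew shape `lam / mu`: a filling of the boxes with letters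
`0, 1, 2, …` which increase weakly along rows and strictly down columns. (The entry is set to `0`
off the shape, so that a filling of the boxes is a tableau in exactly one way.) -/
@[ext]
structure SkewTableau (lam mu : YoungDiagram) where
  entry : ℕ → ℕ → ℕ
  row_weak : ∀ r c₁ c₂ : ℕ, c₁ < c₂ → (r, c₁) ∈ skewCells lam mu → (r, c₂) ∈ skewCells lam mu →
    entry r c₁ ≤ entry r c₂
  col_strict : ∀ r₁ r₂ c : ℕ, r₁ < r₂ → (r₁, c) ∈ skewCells lam mu → (r₂, c) ∈ skewCells lam mu →
    entry r₁ c < entry r₂ c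
  zeros : ∀ r c : ℕ, (r, c) ∉ skewCells lam mu → entry r c = 0

/-- The content of a tableau: how often each letter occurs. -/
noncomputable def SkewTableau.weight {lam mu : YoungDiagram} (T : SkewTableau lam mu) : ℕ →₀ ℕ :=
  ∑ b ∈ skewCells lam mu, Finsupp.single (T.entry b.1 b.2) 1

/-- The skew Schur function `s_{lam / mu} = ∑_T x^T` in the variables `x₀, x₁, …`: the coefficient
of `x^m` is the (finite) number of semistandard tableaux of shape `lam / mu` and content `m`. -/
noncomputable def skewSchur (lam mu : YoungDiagram) : MvPowerSeries ℕ ℚ :=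
  fun m => (Nat.card {T : SkewTableau lam mu // T.weight = m} : ℚ)

/-- The Schur function `s_ν`. -/
noncomputable def schur (ν : YoungDiagram) : MvPowerSeries ℕ ℚ :=
  skewSchur ν ⊥

/-- The Schur support of `lam / mu`: the partitions `ν` such that `s_ν` has a nonzero coefficient in
the expansion `c` of `s_{lam / mu}` as a linear combination of Schur functions. -/
def schurSupport (lam mu : YoungDiagram) : Set YoungDiagram :=
  {ν | ∃ c : YoungDiagram →₀ ℚ,
    skewSchur lam mu = c.sum (fun κ a => a • schur κ) ∧ c ν ≠ 0}

/-- `lam / mu` is a ribbon (a skew shape without a `2 × 2` block of boxes, not necessarily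
connected) whose row lengths, from top to bottom, are the parts of the partition `α`. -/
structure IsRibbonWithRows (α lam mu : YoungDiagram) : Prop where
  le : mu ≤ lam
  rowLen_eq : ∀ r : ℕ, lam.rowLen r = mu.rowLen r + α.rowLen r
  no_square : ∀ r c : ℕ, ¬ ((r, c) ∈ skewCells lam mu ∧ (r, c + 1) ∈ skewCells lam mu ∧
    (r + 1, c) ∈ skewCells lam mu ∧ (r + 1, c + 1) ∈ skewCells lam mu)

/-- The overlapping partition: `overlap lam mu i` is the number of columns of length two in the
diagram formed by the rows `i, i + 1, …` (counted from `0`) of `lam / mu`. It is the part with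
index `i + 1` when parts are counted from `1`. -/
def overlap (lam mu : YoungDiagram) (i : ℕ) : ℕ :=
  ((Finset.range (lam.rowLen 0)).filter
    (fun c => ((skewCells lam mu).filter (fun b => i ≤ b.1 ∧ b.2 = c)).card = 2)).card

/-- The number of nonzero entries among the first `ℓ(α)` entries of `p`, that is, `ℓ(p)`. -/
def overlapLength (α : YoungDiagram) (p : ℕ → ℕ) : ℕ :=
  ((Finset.range (α.colLen 0)).filter (fun i => p i ≠ 0)).card

/-- `ϱ_i = 1 + (α_{i+1} + ⋯ + α_ℓ) - p_{i+1}` (parts counted from `1`). The subtraction is exact for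
the overlapping partition `p` of a ribbon with rows `α`. -/
def rho (α : YoungDiagram) (p : ℕ → ℕ) (i : ℕ) : ℕ :=
  (1 + ∑ q ∈ Finset.Ico i (α.colLen 0), α.rowLen q) - p i

/-- The entries `[ϱ_i - α_j]₊` of the `i`-witness vector, for `j = 0, …, i - 1` (truncated
subtraction is the positive part). -/
def witness (α : YoungDiagram) (p : ℕ → ℕ) (i j : ℕ) : ℕ :=
  rho α p i - α.rowLen j

/-- The size of the `i`-witness vector. -/
def witnessSize (α : YoungDiagram) (p : ℕ → ℕ) (i : ℕ) : ℕ :=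
  ∑ j ∈ Finset.range i, witness α p i j

/-- The decreasing rearrangement of
`(α_1 + g_1, …, α_i + g_i, ϱ_i, p_{i+1} - 1 - |g|)`, where `g` is the `i`-witness vector. -/
def witnessPartition (α : YoungDiagram) (p : ℕ → ℕ) (i : ℕ) : YoungDiagram :=
  decreasingRearrangement
    ((Multiset.range i).map (fun j => α.rowLen j + witness α p i j) +
      {rho α p i, p i - 1 - witnessSize α p i})

end MonotoneRibbon

/-! ### Arithmetic of admissible partitions and removal of the outermost strip -/

namespace MonotoneRibbon

open Finset

/-! The theorem rests on an explicit description of the support. Count rows from 0, let A i be the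
number of boxes of the ribbon in rows i, i+1, …, and put c i = A i - p i. Then ν is in the support
exactly when it has size |α|, dominates α, and satisfies ν i ≤ c i for all i
(`mem_schurSupport_iff_admissible`). The Schur interval imposes this bound only for i = 0. So the
inclusion is strict exactly when some ν in the interval has ν i ≥ c i + 1 = ϱ_i at some i ≥ 1. All
rows before i are then at least ϱ_i too, and dominance over α makes them sum to at least Σ max(α_j,
ϱ_i); comparison with |α| gives |g| < p i (`RibbonNumbers.sum_lt_overlap`). Conversely, if |g| < p
i, raise the first i rows of α to ϱ_i where they are shorter, take ϱ_i as row i, and put the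
remaining boxes in one last row: this is in the interval and breaks the bound at row i.

The support is found in two stages. A ribbon tableau is the same as the list of contents of its
rows, subject to one condition at each overlap: the smallest letter of the row is less than the
largest letter of the next. Where this fails, the two rows merge, in a unique way, into one longer
row. Chains of horizontal strips building up ν, in which at each overlap some box of a strip lies
lower than some box of the strip added just before it, obey the same merging rule. Hence `Splits.eq`
reduces the comparison of the two counts to the case without overlaps, a product of complete
polynomials, where it is the iterated Pieri rule (`sum_sequenceCount_schurPoly`). By
`linearIndependent_schur`, the coefficient of s_ν is the number of such chains.

It remains to see when a chain exists. The bounds are necessary because a strip that descends has a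
box outside row 0. For sufficiency, remove the strip of size α_0 so that what remains is as dominant
as the bounds c (i+1) allow (`exists_admissible_step`). Rows of length at least 2 against at most
one overlap per row give the room needed, and moving one box secures the next descent. -/

/-- Greedy filling from the left: a total `s` is distributed below the bound `z`. -/
theorem exists_greedy (z : ℕ → ℕ) (N s : ℕ) (hs : s ≤ ∑ i ∈ range N, z i) :
    ∃ w : ℕ → ℕ, (∀ i, w i ≤ z i) ∧ ∑ i ∈ range N, w i = s ∧ (∀ i, N ≤ i → w i = 0) ∧
      ∀ x y, x < y → w x = z x ∨ w y = 0 := by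
  induction N generalizing s with
  | zero =>
    refine ⟨fun _ => 0, by simp, ?_, by simp, by simp⟩
    simpa using hs.antisymm (Nat.zero_le _) |>.symm
  | succ N ih =>
    rcases le_or_gt s (∑ i ∈ range N, z i) with h | h
    · obtain ⟨w, h1, h2, h3, h4⟩ := ih s h
      exact ⟨w, h1, by rw [sum_range_succ, h2, h3 N le_rfl, add_zero],
        fun i hi => h3 i (by omega), h4⟩
    · rw [sum_range_succ] at hs
      generalize hS : ∑ i ∈ range N, z i = S at hs h
      refine ⟨fun i => if i < N then z i else if i = N then s - S else 0, ?_, ?_, ?_, ?_⟩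
      · intro i
        dsimp only
        split_ifs with h1 h2
        · exact le_rfl
        · subst h2; omega
        · exact Nat.zero_le _
      · rw [sum_range_succ, sum_congr rfl (g := z) (fun i hi => by simp [mem_range.1 hi]), hS]
        simp only [lt_irrefl, if_false, if_true]
        omega
      · intro i hi
        simp only [show ¬ i < N by omega, show i ≠ N by omega, if_false]
      · intro x y hxy
        by_cases hy : y ≤ N
        · left; simp [show x < N by omega]
        · right; simp only [show ¬ y < N by omega, show y ≠ N by omega, if_false]

/-- The numerical data of a monotone ribbon: row lengths `a`, their tail sums `A`, and the tail
sums `p` of the indicator `δ` of the rows that overlap with the next one. -/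
structure RibbonNumbers (l : ℕ) (a A p δ c : ℕ → ℕ) : Prop where
  anti : Antitone a
  tail : ∀ i, A i = a i + A (i + 1)
  overlap_tail : ∀ i, p i = δ i + p (i + 1)
  overlap_le : ∀ i, i < l → p i + i + 1 ≤ l
  overlap_zero : ∀ i, l ≤ i → p i = 0
  tail_ge : ∀ i, 2 * l ≤ A i + 2 * i
  tail_zero : ∀ i, l ≤ i → A i = 0
  bound : ∀ i, c i + p i = A i

/-- `ν` dominates `a` and its rows are bounded by `c`. -/
structure Admissible (l : ℕ) (a A c : ℕ → ℕ) (ν : ℕ → ℕ) : Prop where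
  anti : Antitone ν
  zero : ∀ i, l ≤ i → ν i = 0
  total : ∑ j ∈ range l, ν j = A 0
  dom : ∀ r, ∑ j ∈ range r, a j ≤ ∑ j ∈ range r, ν j
  cap : ∀ i, ν i ≤ c i

variable {l : ℕ} {a A p δ c ν : ℕ → ℕ}

theorem RibbonNumbers.sum_add_tail (h : RibbonNumbers l a A p δ c) (r : ℕ) :
    ∑ j ∈ range r, a j + A r = A 0 := by
  induction r with
  | zero => simp
  | succ r ih => rw [sum_range_succ]; have := h.tail r; omega

theorem RibbonNumbers.sum_succ_add_tail (h : RibbonNumbers l a A p δ c) (r : ℕ) :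
    ∑ j ∈ range r, a (j + 1) + A (r + 1) = A 1 := by
  induction r with
  | zero => simp
  | succ r ih => rw [sum_range_succ]; have := h.tail (r + 1); omega

/-- Each of the rows from i on has at least two boxes and accounts for at most one overlap. -/
theorem RibbonNumbers.bound_ge (h : RibbonNumbers l a A p δ c) (i : ℕ) : l ≤ c i + i := by
  have := h.bound i
  have := h.tail_ge i
  rcases lt_or_ge i l with hi | hi
  · have := h.overlap_le i hi; omega
  · omega

/-- Two rows `j < t` at which `ν` exceeds the next bound leave little room. -/
theorem overlap_le_sum_of_lt (h : RibbonNumbers l a A p δ c) (hν : Admissible l a A c ν) {j t : ℕ}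
    (hjt : j < t) (ht : c (t + 1) < ν t) :
    p (j + 1) ≤ ∑ s ∈ Ico (j + 1) (t + 1), min (ν s) (c (s + 1)) := by
  have htl : t < l := by
    by_contra hcon
    have := hν.zero t (by omega)
    omega
  rw [sum_Ico_succ_top (by omega), min_eq_right ht.le]
  have h1 : t - (j + 1) ≤ ∑ s ∈ Ico (j + 1) t, min (ν s) (c (s + 1)) := by
    have : ∑ s ∈ Ico (j + 1) t, 1 ≤ ∑ s ∈ Ico (j + 1) t, min (ν s) (c (s + 1)) := by
      refine sum_le_sum fun s hs => ?_
      rw [mem_Ico] at hs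
      have h2 := hν.anti (show s ≤ t by omega)
      have h3 := h.bound_ge (s + 1)
      rw [le_min_iff]
      omega
    simpa using this
  have h4 := h.bound_ge (t + 1)
  have h5 := h.overlap_le (j + 1) (by omega)
  omega

theorem sum_min_first {j r : ℕ} (hjr : j < r)
    (hj : c (j + 1) < ν j) (hfirst : ∀ t < j, ν t ≤ c (t + 1)) :
    ∑ s ∈ range r, min (ν s) (c (s + 1)) =
      ∑ s ∈ range j, ν s + c (j + 1) + ∑ s ∈ Ico (j + 1) r, min (ν s) (c (s + 1)) := by
  rw [← sum_range_add_sum_Ico _ (show j + 1 ≤ r by omega), sum_range_succ, min_eq_right hj.le]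
  congr 2
  exact sum_congr rfl fun s hs => min_eq_left (hfirst s (mem_range.1 hs))

theorem Admissible.sum_range_le (hν : Admissible l a A c ν) (r : ℕ) :
    ∑ s ∈ range r, ν s ≤ A 0 := by
  rw [← hν.total]
  rcases le_total r l with h | h
  · exact sum_le_sum_of_subset (range_mono h)
  · rw [← sum_range_add_sum_Ico _ h, sum_eq_zero (s := Ico l r)]
    · simp
    · intro i hi; exact hν.zero i (mem_Ico.1 hi).1

theorem Admissible.sum_range_eq (hν : Admissible l a A c ν) {r : ℕ} (hr : ν r = 0) :
    ∑ s ∈ range r, ν s = A 0 := by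
  have h0 : ∀ i, r ≤ i → ν i = 0 := fun i hi => Nat.le_zero.1 (hr ▸ hν.anti hi)
  rw [← hν.total]
  rcases le_total r l with h | h
  · rw [← sum_range_add_sum_Ico _ h, sum_eq_zero (s := Ico r l), add_zero]
    intro i hi; exact h0 i (mem_Ico.1 hi).1
  · rw [← sum_range_add_sum_Ico _ h, sum_eq_zero (s := Ico l r), add_zero]
    intro i hi; exact hν.zero i (mem_Ico.1 hi).1

/-- The partition κ left after removing a strip must satisfy κ j ≤ min (ν j) (c (j + 1)); this says
that the largest such rows still dominate the remaining row lengths. Only a row j with ν j > c (j +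
1) can cause a loss, and the first such row loses at most c j - c (j + 1) = a j - δ j ≤ a 0, which
is what passing from A 0 to A 1 permits. If later rows lose as well, or r cuts ν off, the rows after
j must make up for at most p (j + 1). -/
theorem sum_succ_le_sum_min (h : RibbonNumbers l a A p δ c) (hν : Admissible l a A c ν) (r : ℕ) :
    ∑ j ∈ range r, a (j + 1) ≤ ∑ j ∈ range r, min (ν j) (c (j + 1)) := by
  have hr := h.sum_succ_add_tail r
  have hA : A 0 = a 0 + A 1 := h.tail 0
  by_cases hall : ∀ j < r, ν j ≤ c (j + 1)
  · calc ∑ j ∈ range r, a (j + 1) ≤ ∑ j ∈ range r, a j :=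
          sum_le_sum fun j _ => h.anti (Nat.le_succ j)
      _ ≤ ∑ j ∈ range r, ν j := hν.dom r
      _ = _ := sum_congr rfl fun j hj => (min_eq_left (hall j (mem_range.1 hj))).symm
  · push Not at hall
    obtain ⟨j, ⟨hjr, hj⟩, hmin⟩ : ∃ j, (j < r ∧ c (j + 1) < ν j) ∧
        ∀ t < j, ¬ (t < r ∧ c (t + 1) < ν t) := by
      classical
      exact ⟨Nat.find hall, Nat.find_spec hall, fun t ht => Nat.find_min hall ht⟩
    have hfirst : ∀ t < j, ν t ≤ c (t + 1) := fun t ht => by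
      have := hmin t ht; omega
    rw [sum_min_first hjr hj hfirst]
    have hdomj := hν.dom j
    have hsj := h.sum_add_tail j
    have htj := h.tail j
    have hbj := h.bound (j + 1)
    have hbj' := h.bound j
    have hpj := h.overlap_tail j
    have haj := h.anti (Nat.zero_le j)
    have hcj := hν.cap j
    by_cases h2 : ∃ t, j < t ∧ t < r ∧ c (t + 1) < ν t
    · obtain ⟨t, hjt, htr, ht⟩ := h2
      have h3 := overlap_le_sum_of_lt h hν hjt ht
      have h4 : ∑ s ∈ Ico (j + 1) (t + 1), min (ν s) (c (s + 1)) ≤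
          ∑ s ∈ Ico (j + 1) r, min (ν s) (c (s + 1)) :=
        sum_le_sum_of_subset (Ico_subset_Ico le_rfl (by omega))
      omega
    · push Not at h2
      have h3 : ∑ s ∈ Ico (j + 1) r, min (ν s) (c (s + 1)) = ∑ s ∈ Ico (j + 1) r, ν s :=
        sum_congr rfl fun s hs => min_eq_left (h2 s (by have := mem_Ico.1 hs; omega)
          (mem_Ico.1 hs).2)
      rw [h3]
      -- If ν ends before row r, everything except the loss in row j is counted. Otherwise each row
      -- between j and r contributes at least 1, and the rows of `a` beyond r, of length at least 2,
      -- cover the rest of p (j + 1).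
      by_cases h4 : ν r = 0
      · have h5 := hν.sum_range_eq h4
        rw [← sum_range_add_sum_Ico _ (show j + 1 ≤ r by omega), sum_range_succ] at h5
        omega
      · have h5 : r - (j + 1) ≤ ∑ s ∈ Ico (j + 1) r, ν s := by
          have : ∑ s ∈ Ico (j + 1) r, 1 ≤ ∑ s ∈ Ico (j + 1) r, ν s := by
            refine sum_le_sum fun s hs => ?_
            have := hν.anti (mem_Ico.1 hs).2.le
            omega
          simpa using this
        have h6 : r < l := by
          by_contra hcon
          exact h4 (hν.zero r (by omega))
        have h7 := h.tail_ge (r + 1)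
        have h8 := h.overlap_le (j + 1) (by omega)
        have h9 : ∑ s ∈ range j, a (s + 1) ≤ ∑ s ∈ range j, a s :=
          sum_le_sum fun s _ => h.anti (Nat.le_succ s)
        have h10 := h.sum_succ_add_tail j
        omega

/-- A row `j ≥ 1` can only attain its bound, without slack elsewhere, in the excluded way. -/
theorem false_of_attained (h : RibbonNumbers l a A p δ c) {j : ℕ}
    (hj : 1 ≤ j) (hjl : j < l) (haj : a j = a 0) (hδ : δ j = 0)
    (hex : (j + 1) * c j < A 0) : False := by
  have h1 := h.sum_add_tail j
  have h2 : ∑ s ∈ range j, a s = j * a 0 := by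
    rw [sum_congr rfl (g := fun _ => a 0)]
    · simp
    · intro s hs
      have := h.anti (mem_range.1 hs).le
      have := h.anti (Nat.zero_le s)
      omega
  have h3 := h.tail j
  have h4 := h.bound j
  have h5 := h.bound (j + 1)
  have h6 := h.overlap_tail j
  have h7 := h.tail_ge (j + 1)
  have h8 := h.overlap_le j hjl
  have h9 : a 0 + p j ≤ c j := by omega
  have h10 : j * (a 0 + p j) ≤ j * c j := Nat.mul_le_mul_left _ h9
  have h11 : 1 * p j ≤ j * p j := Nat.mul_le_mul_right _ hj
  rw [mul_add] at h10
  rw [add_mul] at hex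
  omega

/-- Strictness is what forces the greedy strip to meet the last row k of ν. Equality would need a
single losing row j with ν j = c j, a j = a 0 and δ j = 0. Then j ≥ 1 because δ 0 = 1, and
`false_of_attained` applies, since the first j + 1 rows are at least c j and row k is nonempty. -/
theorem sum_min_gt (h : RibbonNumbers l a A p δ c) (hν : Admissible l a A c ν)
    (hδ : δ 0 = 1) (ha : 0 < a 0) {k : ℕ} (hk : ν k ≠ 0) (hk1 : ν (k + 1) = 0)
    (hkc : ν k ≤ c (k + 1)) :
    A 1 < ∑ j ∈ range (k + 1), min (ν j) (c (j + 1)) := by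
  have hA : A 0 = a 0 + A 1 := h.tail 0
  have htot := hν.sum_range_eq hk1
  by_cases hall : ∀ j < k + 1, ν j ≤ c (j + 1)
  · rw [sum_congr rfl (g := ν) fun j hj => min_eq_left (hall j (mem_range.1 hj)), htot]
    omega
  · push Not at hall
    obtain ⟨j, ⟨hjr, hj⟩, hmin⟩ : ∃ j, (j < k + 1 ∧ c (j + 1) < ν j) ∧
        ∀ t < j, ¬ (t < k + 1 ∧ c (t + 1) < ν t) := by
      classical
      exact ⟨Nat.find hall, Nat.find_spec hall, fun t ht => Nat.find_min hall ht⟩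
    have hfirst : ∀ t < j, ν t ≤ c (t + 1) := fun t ht => by
      have := hmin t ht; omega
    have hjk : j ≠ k := by rintro rfl; omega
    have hkl : k < l := by
      by_contra hcon
      exact hk (hν.zero k (by omega))
    rw [sum_min_first hjr hj hfirst]
    have hdomj := hν.dom j
    have hsj := h.sum_add_tail j
    have htj := h.tail j
    have hbj := h.bound (j + 1)
    have hbj' := h.bound j
    have hpj := h.overlap_tail j
    have haj := h.anti (Nat.zero_le j)
    have hcj := hν.cap j
    by_cases h2 : ∃ t, j < t ∧ t < k + 1 ∧ c (t + 1) < ν t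
    · obtain ⟨t, hjt, htr, ht⟩ := h2
      have h3 := overlap_le_sum_of_lt h hν hjt ht
      have htk : t ≠ k := by rintro rfl; omega
      have h4 : ∑ s ∈ Ico (j + 1) (t + 1), min (ν s) (c (s + 1)) ≤
          ∑ s ∈ Ico (j + 1) k, min (ν s) (c (s + 1)) :=
        sum_le_sum_of_subset (Ico_subset_Ico le_rfl (by omega))
      rw [sum_Ico_succ_top (by omega), min_eq_left hkc]
      omega
    · push Not at h2
      have h3 : ∑ s ∈ Ico (j + 1) (k + 1), min (ν s) (c (s + 1)) =
          ∑ s ∈ Ico (j + 1) (k + 1), ν s :=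
        sum_congr rfl fun s hs => min_eq_left (h2 s (by have := mem_Ico.1 hs; omega)
          (mem_Ico.1 hs).2)
      rw [h3]
      have h5 := htot
      rw [← sum_range_add_sum_Ico _ (show j + 1 ≤ k + 1 by omega), sum_range_succ] at h5
      by_contra hcon
      have hj0 : j ≠ 0 := by
        rintro rfl; omega
      refine false_of_attained h (j := j) (by omega) (by omega) (by omega) (by omega) ?_
      have h6 : j * c j ≤ ∑ s ∈ range j, ν s := by
        have : ∑ s ∈ range j, c j ≤ ∑ s ∈ range j, ν s := by
          refine sum_le_sum fun s hs => ?_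
          have := hν.anti (mem_range.1 hs).le
          omega
        simpa using this
      have h7 : ν k ≤ ∑ s ∈ Ico (j + 1) (k + 1), ν s :=
        single_le_sum (f := ν) (fun _ _ => Nat.zero_le _) (mem_Ico.2 (by omega))
      rw [add_mul]
      omega

/-- Filling from the top makes κ as large as possible in dominance order among the partitions with κ
i between ν (i + 1) and min (ν i) (c (i + 1)). The last clause records this extremality. -/
theorem exists_greedy_strip (h : RibbonNumbers (l + 1) a A p δ c)
    (hν : Admissible (l + 1) a A c ν) :
    ∃ κ : ℕ → ℕ, (∀ i, ν (i + 1) ≤ κ i) ∧ (∀ i, κ i ≤ min (ν i) (c (i + 1))) ∧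
      (∀ r, l + 1 ≤ r → ∑ i ∈ range r, κ i = A 1) ∧
      ∀ x y, x < y → κ x = min (ν x) (c (x + 1)) ∨ κ y = ν (y + 1) := by
  have hle : ∀ i, ν (i + 1) ≤ min (ν i) (c (i + 1)) := fun i =>
    le_min (hν.anti (Nat.le_succ i)) (hν.cap (i + 1))
  have hA : A 0 = a 0 + A 1 := h.tail 0
  have h0 : a 0 ≤ ν 0 := by simpa using hν.dom 1
  have hsh : ∀ r, l + 1 ≤ r → ν 0 + ∑ i ∈ range r, ν (i + 1) = A 0 := fun r hr => by
    rw [add_comm, ← sum_range_succ' ν]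
    exact hν.sum_range_eq (hν.zero _ (by omega))
  have hmin := sum_succ_le_sum_min h hν (l + 1)
  have htail := h.sum_succ_add_tail (l + 1)
  have hz := h.tail_zero (l + 1 + 1) (by omega)
  have hsum : ∑ i ∈ range (l + 1), (min (ν i) (c (i + 1)) - ν (i + 1)) +
      ∑ i ∈ range (l + 1), ν (i + 1) = ∑ i ∈ range (l + 1), min (ν i) (c (i + 1)) := by
    rw [← sum_add_distrib]
    exact sum_congr rfl fun i _ => Nat.sub_add_cancel (hle i)
  have hsl := hsh (l + 1) le_rfl
  -- The rows ν (i + 1) already hold A 0 - ν 0 boxes, so ν 0 - a 0 more are needed to reach A 1.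
  obtain ⟨w, hw1, hw2, hw3, hw4⟩ := exists_greedy
    (fun i => min (ν i) (c (i + 1)) - ν (i + 1)) (l + 1) (ν 0 - a 0) (by omega)
  refine ⟨fun i => ν (i + 1) + w i, fun i => Nat.le_add_right _ _, fun i => ?_, fun r hr => ?_,
    fun x y hxy => ?_⟩
  · have := hw1 i
    have := hle i
    dsimp only at *
    omega
  · rw [sum_add_distrib]
    have h1 : ∑ i ∈ range r, w i = ν 0 - a 0 := by
      rw [← hw2, ← sum_range_add_sum_Ico _ hr, sum_eq_zero (s := Ico _ r), add_zero]
      intro i hi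
      exact hw3 i (mem_Ico.1 hi).1
    have := hsh r hr
    omega
  · have := hle x
    rcases hw4 x y hxy with h1 | h1
    · left; dsimp only at *; omega
    · right; dsimp only at *; omega

/-- Removing the last strip: an admissible `ν` contains an admissible partition for the remaining
rows, and the strip between them meets the last row, and some other row, whenever needed. -/
theorem exists_admissible_step (h : RibbonNumbers (l + 1) a A p δ c)
    (hν : Admissible (l + 1) a A c ν) (ha : 2 ≤ a 0) :
    ∃ κ : ℕ → ℕ, (∀ i, ν (i + 1) ≤ κ i ∧ κ i ≤ ν i) ∧
      Admissible l (fun i => a (i + 1)) (fun i => A (i + 1)) (fun i => c (i + 1)) κ ∧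
      ∀ k, ν k ≠ 0 → ν (k + 1) = 0 →
        (δ 0 = 1 → κ k < ν k) ∧ (ν k < ν 0 → ∃ j < k, κ j < ν j) := by
  obtain ⟨κ, hκ1, hκ2, hκ3, hκ4⟩ := exists_greedy_strip h hν
  have hA : A 0 = a 0 + A 1 := h.tail 0
  have hκν : ∀ i, κ i ≤ ν i := fun i => (hκ2 i).trans (min_le_left _ _)
  have hκc : ∀ i, κ i ≤ c (i + 1) := fun i => (hκ2 i).trans (min_le_right _ _)
  have hcz : ∀ i, l ≤ i → c (i + 1) = 0 := fun i hi => by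
    have h1 := h.bound (i + 1)
    have h2 := h.tail_zero (i + 1) (by omega)
    omega
  have hκz : ∀ i, l ≤ i → κ i = 0 := fun i hi => by
    have := hκc i
    have := hcz i hi
    omega
  have hκt : ∑ j ∈ range l, κ j = A 1 := by
    have := hκ3 (l + 1) le_rfl
    rwa [sum_range_succ, hκz l le_rfl, add_zero] at this
  have hκA : Admissible l (fun i => a (i + 1)) (fun i => A (i + 1)) (fun i => c (i + 1)) κ := by
    refine ⟨antitone_nat_of_succ_le fun i => (hκν (i + 1)).trans (hκ1 i), hκz, hκt, fun r => ?_,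
      hκc⟩
    -- Either the greedy filling is not exhausted before row r, and the first r rows are all
    -- maximal; or κ is the shift of ν from row r on, and dominance comes from that of ν at r + 1.
    by_cases hex : ∃ y, r ≤ y ∧ κ y ≠ ν (y + 1)
    · obtain ⟨y, hy, hne⟩ := hex
      refine (sum_succ_le_sum_min h hν r).trans_eq (sum_congr rfl fun x hx => ?_)
      exact ((hκ4 x y ((mem_range.1 hx).trans_le hy)).resolve_right hne).symm
    · push Not at hex
      have h1 := hκ3 (r + (l + 1)) (by omega)
      have h2 := hν.sum_range_eq (r := r + (l + 1) + 1) (hν.zero _ (by omega))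
      have h3 := hν.dom (r + 1)
      rw [← sum_range_add_sum_Ico _ (show r ≤ r + (l + 1) by omega)] at h1
      rw [sum_range_succ', ← sum_range_add_sum_Ico _ (show r ≤ r + (l + 1) by omega)] at h2
      rw [sum_range_succ', sum_range_succ'] at h3
      rw [sum_congr rfl fun i hi => hex i (mem_Ico.1 hi).1] at h1
      omega
  have hlast : ∀ k, ν k ≠ 0 → ν (k + 1) = 0 → δ 0 = 1 → κ k < ν k := by
    intro k hk hk1 hδ0
    refine lt_of_le_of_ne (hκν k) fun heq => ?_
    have hkc : ν k ≤ c (k + 1) := heq ▸ hκc k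
    have h1 := sum_min_gt h hν hδ0 (by omega) hk hk1 hkc
    have h2 : ∑ j ∈ range (k + 1), min (ν j) (c (j + 1)) = ∑ j ∈ range (k + 1), κ j := by
      refine sum_congr rfl fun x hx => ?_
      rcases eq_or_lt_of_le (Nat.lt_succ_iff.1 (mem_range.1 hx)) with rfl | hlt
      · rw [heq, min_eq_left hkc]
      · exact ((hκ4 x k hlt).resolve_right (by omega)).symm
    have h3 : _ ≤ A 1 := hκA.sum_range_le (k + 1)
    omega
  by_cases hgood : ∀ k, ν k ≠ 0 → ν (k + 1) = 0 → ν k < ν 0 → ∃ j < k, κ j < ν j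
  · exact ⟨κ, fun i => ⟨hκ1 i, hκν i⟩, hκA, fun k hk hk1 => ⟨hlast k hk hk1, hgood k hk hk1⟩⟩
  -- In the remaining case the whole strip lies in the last row k although ν is not a rectangle.
  -- Moving one box of κ from a corner row j < k to row k makes the strip meet both rows.
  push Not at hgood
  obtain ⟨k, hk, hk1, hk0, hkκ⟩ := hgood
  have hkz : ∀ i, k < i → ν i = 0 := fun i hi => Nat.le_zero.1 (hk1 ▸ hν.anti hi)
  have hkpos : k ≠ 0 := by rintro rfl; omega
  have hκeq : ∀ j < k, κ j = ν j := fun j hj => le_antisymm (hκν j) (hkκ j hj)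
  obtain ⟨j, hjk, hj⟩ : ∃ j < k, ν (j + 1) < ν j := by
    by_contra! hcon
    have : ∀ i ≤ k, ν 0 ≤ ν i := by
      intro i
      induction i with
      | zero => simp
      | succ i ih => intro hi; exact (ih (by omega)).trans (hcon i (by omega))
    exact absurd (this k le_rfl) (by omega)
  have hkl : k < l + 1 := by
    by_contra hcon
    exact hk (hν.zero k (by omega))
  have hνsum : ∑ i ∈ range k, ν i + ν k = A 0 := by
    rw [← sum_range_succ]; exact hν.sum_range_eq hk1
  have hκk : κ k + a 0 = ν k := by
    have h1 : _ = A 1 := hκA.sum_range_eq (r := k + 1)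
      (Nat.le_zero.1 (hk1 ▸ hκν (k + 1)))
    have h2 : ∑ i ∈ range k, κ i = ∑ i ∈ range k, ν i :=
      sum_congr rfl fun i hi => hκeq i (mem_range.1 hi)
    rw [sum_range_succ] at h1
    omega
  have hkle : ∀ i ≤ k, ν k ≤ ν i := fun i hi => hν.anti hi
  have hstrict : k * ν k < ∑ i ∈ range k, ν i := by
    have : ∑ i ∈ range k, ν k < ∑ i ∈ range k, ν i :=
      sum_lt_sum (fun i hi => hkle i (mem_range.1 hi).le) ⟨0, mem_range.2 (by omega), hk0⟩
    simpa using this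
  -- If row k of κ were full, then ν k = c k, a k = a 0 and δ k = 0; with k * ν k smaller than the
  -- sum of the rows above, this is the excluded configuration.
  have hck : κ k + 1 ≤ c (k + 1) := by
    by_contra hcon
    have h1 := hν.cap k
    have h2 := h.bound k
    have h3 := h.bound (k + 1)
    have h4 := h.tail k
    have h5 := h.overlap_tail k
    have h6 := h.anti (Nat.zero_le k)
    have h7 := hκc k
    refine false_of_attained h (j := k) (by omega) hkl (by omega) (by omega) ?_
    have h8 : ν k = c k := by omega
    rw [← h8, add_mul]
    omega
  have hjs : ∀ f : ℕ → ℕ, f = (fun i => if i = j then ν j - 1 else if i = k then κ k + 1 else κ i) →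
      ((∀ i, ν (i + 1) ≤ f i ∧ f i ≤ ν i) ∧ (∀ i, f i ≤ c (i + 1))) := by
    rintro f rfl
    refine ⟨fun i => ⟨?_, ?_⟩, fun i => ?_⟩ <;> dsimp only <;> split_ifs with h1 h2
    · subst h1; omega
    · subst h2; omega
    · exact hκ1 i
    · subst h1; omega
    · subst h2; omega
    · exact hκν i
    · subst h1; have := hκc i; have := hκeq i hjk; omega
    · subst h2; exact hck
    · exact hκc i
  generalize hf : (fun i => if i = j then ν j - 1 else if i = k then κ k + 1 else κ i) = f at hjs
  obtain ⟨hf1, hf2⟩ := hjs f rfl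
  have hfj : f j = ν j - 1 := by rw [← hf]; simp
  have hfk : f k = κ k + 1 := by rw [← hf]; simp [show k ≠ j by omega]
  have hfo : ∀ i, i ≠ j → i ≠ k → f i = κ i := fun i h1 h2 => by rw [← hf]; simp [h1, h2]
  have hfκ : ∀ r, k < r → ∑ i ∈ range r, f i = ∑ i ∈ range r, κ i := by
    intro r hr
    have hkr : k ∈ (range r).erase j := by simp; omega
    have hjr : j ∈ range r := by simp; omega
    have hrest : ∑ i ∈ ((range r).erase j).erase k, f i = ∑ i ∈ ((range r).erase j).erase k, κ i :=
      sum_congr rfl fun i hi => hfo i (by simp at hi; omega) (by simp at hi; omega)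
    rw [← add_sum_erase _ _ hjr, ← add_sum_erase _ κ hjr, ← add_sum_erase _ _ hkr,
      ← add_sum_erase _ κ hkr, hfj, hfk, hκeq j hjk, hrest]
    have := hkle j hjk.le
    omega
  refine ⟨f, hf1, ⟨antitone_nat_of_succ_le fun i => (hf1 (i + 1)).2.trans (hf1 i).1, fun i hi => ?_,
    ?_, fun r => ?_, hf2⟩, fun k' hk' hk1' => ?_⟩
  · have := hf2 i
    have := hcz i hi
    omega
  · have h1 := hf2 l
    have h2 := hcz l le_rfl
    have h3 := hfκ (l + 1) hkl
    rw [sum_range_succ, sum_range_succ, hκt, hκz l le_rfl] at h3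
    change _ = A 1
    omega
  · rcases lt_or_ge k r with hr | hr
    · rw [hfκ r hr]; exact hκA.dom r
    -- Dominance survives row by row: f i ≥ ν (i + 1) ≥ ν k = κ k + a 0 ≥ a (i + 1).
    · refine sum_le_sum fun i hi => ?_
      have h1 := (hf1 i).1
      have h2 := hkle (i + 1) (by have := mem_range.1 hi; omega)
      have h3 := h.anti (Nat.zero_le (i + 1))
      omega
  · have hkk : k' = k := by
      rcases lt_trichotomy k' k with hlt | heq | hlt
      · have := hkle (k' + 1) hlt; omega
      · exact heq
      · exact absurd (hkz k' hlt) hk'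
    subst hkk
    -- Here a 0 ≥ 2 enters: the strip had a 0 boxes in row k, so it still has one there after the
    -- move.
    exact ⟨fun _ => by omega, fun _ => ⟨j, hjk, by omega⟩⟩

end MonotoneRibbon

/-! ### Sequences with prescribed descents and the merging rule -/

namespace MonotoneRibbon

open Finset

/-- Some letter of `u` is related to some letter of `w`. -/
def Descends (R : ℕ → ℕ → Prop) (u w : ℕ →₀ ℕ) : Prop :=
  ∃ x y, R x y ∧ u x ≠ 0 ∧ w y ≠ 0

open Classical in
/-- The number of sequences `u₀, u₁, …` with sum `r` whose degrees are the first entries of `L`,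
such that `A (u_{i+1} + u_{i+2} + ⋯) u_i` for all `i`, `Descends R u_i u_{i+1}` for every `i` flagged
in `L` which is not the last index, and `P u₀` (if the sequence is not empty). -/
noncomputable def sequenceCount (A : (ℕ →₀ ℕ) → (ℕ →₀ ℕ) → Prop) (R : ℕ → ℕ → Prop) :
    List (ℕ × Bool) → ((ℕ →₀ ℕ) → Prop) → (ℕ →₀ ℕ) → ℕ
  | [], _, r => if r = 0 then 1 else 0
  | (a, f) :: L, P, r =>
    ∑ q ∈ antidiagonal r with q.1.degree = a ∧ A q.2 q.1 ∧ P q.1,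
      sequenceCount A R L (fun w => f = true → Descends R q.1 w) q.2

/-- What is needed to merge two consecutive members of a sequence that do not descend. -/
structure MergeLaws (A : (ℕ →₀ ℕ) → (ℕ →₀ ℕ) → Prop) (R : ℕ → ℕ → Prop) : Prop where
  split : ∀ (z : ℕ →₀ ℕ) (a b : ℕ), z.degree = a + b →
    ∃! q : (ℕ →₀ ℕ) × (ℕ →₀ ℕ), q.1 + q.2 = z ∧ q.1.degree = a ∧ ¬ Descends R q.1 q.2
  merge_iff : ∀ v u w : ℕ →₀ ℕ, ¬ Descends R u w → (A v (u + w) ↔ A v w ∧ A (v + w) u)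
  trans : ∀ x y t : ℕ, ¬ R x t → R x y → R t y

theorem degree_eq_sum_range (u : ℕ →₀ ℕ) {N : ℕ} (hu : ∀ i, N ≤ i → u i = 0) :
    u.degree = ∑ i ∈ range N, u i := by
  rw [Finsupp.degree_apply]
  refine sum_subset (fun i hi => ?_) (fun i _ hi => by simpa using hi)
  rw [mem_range]
  by_contra h
  exact (Finsupp.mem_support_iff.1 hi) (hu i (by omega))

theorem exists_zero_of_le (u : ℕ →₀ ℕ) : ∃ N, ∀ i, N ≤ i → u i = 0 := by
  refine ⟨u.support.sup id + 1, fun i hi => ?_⟩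
  by_contra h
  have := le_sup (f := id) (Finsupp.mem_support_iff.2 h)
  simp only [id] at this
  omega

/-- Not descending means that no letter of the second part exceeds a letter of the first, so the
second part must consist of the b smallest letters of z. -/
theorem existsUnique_split (z : ℕ →₀ ℕ) (a b : ℕ) (hz : z.degree = a + b) :
    ∃! q : (ℕ →₀ ℕ) × (ℕ →₀ ℕ),
      q.1 + q.2 = z ∧ q.1.degree = a ∧ ¬ Descends (· < ·) q.1 q.2 := by
  obtain ⟨N, hN⟩ := exists_zero_of_le z
  refine existsUnique_of_exists_of_unique ?_ ?_
  · obtain ⟨w, hw1, hw2, hw3, hw4⟩ := exists_greedy z N b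
      (by rw [← degree_eq_sum_range z hN]; omega)
    let w' : ℕ →₀ ℕ := Finsupp.onFinset (range N) w fun i hi => by
      rw [mem_range]; by_contra h; exact hi (hw3 i (by omega))
    have hle : w' ≤ z := fun i => hw1 i
    refine ⟨(z - w', w'), tsub_add_cancel_of_le hle, ?_, ?_⟩
    · have h1 : (z - w').degree + w'.degree = z.degree := by
        rw [← map_add, tsub_add_cancel_of_le hle]
      have h2 : w'.degree = b := by
        rw [degree_eq_sum_range w' hw3]; exact hw2
      dsimp only
      omega
    · rintro ⟨x, y, hxy, hx, hy⟩
      rcases hw4 x y hxy with h | h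
      · exact hx (by simp [w', h])
      · exact hy h
  · rintro ⟨u, w⟩ ⟨u', w'⟩ ⟨h1, h2, h3⟩ ⟨h1', h2', h3'⟩
    dsimp only at *
    -- At the first letter x where u has more than u', not descending leaves no letter beyond x for
    -- w. Hence u has all the letters of z beyond x, so u' ≤ u everywhere, and equal degrees give a
    -- contradiction.
    have key : ∀ u w u' w' : ℕ →₀ ℕ, u + w = z → u' + w' = z → u.degree = u'.degree →
        ¬ Descends (· < ·) u w → ∀ x, (∀ y < x, u y = u' y) → ¬ u' x < u x := by
      intro u w u' w' h h' hd hD x hx hlt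
      have hw : ∀ y, x < y → w y = 0 := fun y hy => by
        by_contra hne
        exact hD ⟨x, y, hy, by omega, hne⟩
      have hle : ∀ y, u' y ≤ u y := fun y => by
        rcases lt_trichotomy y x with hy | rfl | hy
        · exact (hx y hy).ge
        · exact hlt.le
        · have e1 := DFunLike.congr_fun h y
          have e2 := DFunLike.congr_fun h' y
          have := hw y hy
          simp only [Finsupp.coe_add, Pi.add_apply] at e1 e2
          omega
      have hsub : u' + (u - u') = u := add_tsub_cancel_of_le hle
      have hdeg : (u - u').degree = 0 := by
        have := congrArg Finsupp.degree hsub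
        rw [map_add] at this
        omega
      rw [Finsupp.degree_eq_zero_iff] at hdeg
      have := DFunLike.congr_fun hdeg x
      simp only [Finsupp.coe_tsub, Pi.sub_apply, Finsupp.coe_zero, Pi.zero_apply] at this
      omega
    have hu : u = u' := by
      ext x
      induction x using Nat.strong_induction_on with
      | _ x ih =>
        have e1 := key u w u' w' h1 h1' (h2.trans h2'.symm) h3 x ih
        have e2 := key u' w' u w h1' h1 (h2'.trans h2.symm) h3' x fun y hy => (ih y hy).symm
        omega
    subst hu
    rw [Prod.mk.injEq]
    exact ⟨rfl, add_left_cancel (h1.trans h1'.symm)⟩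

theorem descends_gt_iff (u w : ℕ →₀ ℕ) : Descends (· > ·) u w ↔ Descends (· < ·) w u :=
  ⟨fun ⟨x, y, h, hx, hy⟩ => ⟨y, x, h, hy, hx⟩, fun ⟨x, y, h, hx, hy⟩ => ⟨y, x, h, hy, hx⟩⟩

/-- Words without further condition. -/
theorem mergeLaws_words : MergeLaws (fun _ _ => True) (· < ·) where
  split := existsUnique_split
  merge_iff := by simp
  trans := by intro x y t; omega

/-- The strip `u` may be added to the partition `v`. -/
def IsStrip (v u : ℕ →₀ ℕ) : Prop :=
  ∀ i, v (i + 1) + u (i + 1) ≤ v i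

/-- If no box of u lies in a lower row than a box of w, then for each i either u (i + 1) or w i
vanishes, so adding w and then u is one horizontal strip. -/
theorem mergeLaws_strips : MergeLaws IsStrip (· > ·) where
  split := by
    intro z a b hz
    obtain ⟨⟨u, w⟩, ⟨h1, h2, h3⟩, huniq⟩ := existsUnique_split z b a (by omega)
    have hdeg := congrArg Finsupp.degree h1
    dsimp only at *
    rw [map_add] at hdeg
    refine ⟨(w, u), ⟨by rw [← h1, add_comm], show w.degree = a by omega,
      by rwa [descends_gt_iff]⟩, ?_⟩
    rintro ⟨u', w'⟩ ⟨h1', h2', h3'⟩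
    dsimp only at *
    have hdeg' := congrArg Finsupp.degree h1'
    rw [map_add] at hdeg'
    have := huniq (w', u') ⟨by rw [← h1', add_comm], show w'.degree = b by omega,
      by rwa [descends_gt_iff] at h3'⟩
    rw [Prod.mk.injEq] at this ⊢
    exact this.symm
  merge_iff := by
    intro v u w hD
    have hD' : ∀ i, u (i + 1) = 0 ∨ w i = 0 := fun i => by
      by_contra! h
      exact hD ⟨i + 1, i, Nat.lt_succ_self i, h.1, h.2⟩
    constructor
    · intro h
      refine ⟨fun i => ?_, fun i => ?_⟩
      · have := h i; simp only [Finsupp.coe_add, Pi.add_apply] at *; omega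
      · have := h i; simp only [Finsupp.coe_add, Pi.add_apply] at *; omega
    · rintro ⟨h1, h2⟩ i
      have e1 := h1 i
      have e2 := h2 i
      have := hD' i
      simp only [Finsupp.coe_add, Pi.add_apply] at *
      omega
  trans := by intro x y t; omega

section

variable {A : (ℕ →₀ ℕ) → (ℕ →₀ ℕ) → Prop} {R : ℕ → ℕ → Prop}

theorem sequenceCount_congr (L : List (ℕ × Bool)) {P Q : (ℕ →₀ ℕ) → Prop} (r : ℕ →₀ ℕ)
    (h : ∀ u, P u ↔ Q u) : sequenceCount A R L P r = sequenceCount A R L Q r := by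
  rw [show P = Q from funext fun u => propext (h u)]

/-- A merged member behaves towards its successor as its second half does: a descent from a letter
of u passes, by `trans`, to any letter of w. This is why w must be nonempty. -/
theorem MergeLaws.descends_add (h : MergeLaws A R) {u w x : ℕ →₀ ℕ} (hw : w ≠ 0)
    (hD : ¬ Descends R u w) : Descends R (u + w) x ↔ Descends R w x := by
  constructor
  · rintro ⟨s, t, hst, hs, ht⟩
    by_cases hws : w s = 0
    · obtain ⟨k, hk⟩ := DFunLike.ne_iff.1 hw
      rw [Finsupp.coe_add, Pi.add_apply, hws, add_zero] at hs
      exact ⟨k, t, h.trans s t k (fun hR => hD ⟨s, k, hR, hs, hk⟩) hst, hk, ht⟩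
    · exact ⟨s, t, hst, hws, ht⟩
  · rintro ⟨s, t, hst, hs, ht⟩
    refine ⟨s, t, hst, ?_, ht⟩
    rw [Finsupp.coe_add, Pi.add_apply]
    omega

/-- Two consecutive members either descend or can be merged, in a unique way. -/
theorem MergeLaws.sequenceCount_merge (h : MergeLaws A R) (a b : ℕ) (hb : 0 < b) (f : Bool)
    (L : List (ℕ × Bool)) (r : ℕ →₀ ℕ) :
    sequenceCount A R ((a, true) :: (b, f) :: L) (fun _ => True) r +
      sequenceCount A R ((a + b, f) :: L) (fun _ => True) r =
      sequenceCount A R ((a, false) :: (b, f) :: L) (fun _ => True) r := by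
  classical
  simp only [sequenceCount, and_true, forall_const, Bool.false_eq_true, false_implies]
  -- Sequences starting with a merged member correspond to sequences starting with two members that
  -- do not descend; the unflagged count is the sum over both kinds of pairs.
  have hmerge : ∑ q ∈ antidiagonal r with q.1.degree = a + b ∧ A q.2 q.1,
        sequenceCount A R L (fun w => f = true → Descends R q.1 w) q.2 =
      ∑ q ∈ antidiagonal r with q.1.degree = a ∧ A q.2 q.1,
        ∑ q' ∈ antidiagonal q.2 with (q'.1.degree = b ∧ A q'.2 q'.1) ∧ ¬ Descends R q.1 q'.1,
          sequenceCount A R L (fun w => f = true → Descends R q'.1 w) q'.2 := by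
    have h1 : ∀ q ∈ (antidiagonal r).filter (fun q => q.1.degree = a + b ∧ A q.2 q.1),
        sequenceCount A R L (fun w => f = true → Descends R q.1 w) q.2 =
        ∑ q' ∈ antidiagonal q.1 with q'.1.degree = a ∧ ¬ Descends R q'.1 q'.2,
          sequenceCount A R L (fun w => f = true → Descends R q'.2 w) q.2 := by
      intro q hq
      rw [mem_filter] at hq
      obtain ⟨⟨u, w⟩, ⟨e1, e2, e3⟩, huniq⟩ := h.split q.1 a b hq.2.1
      rw [show (antidiagonal q.1).filter (fun q' => q'.1.degree = a ∧ ¬ Descends R q'.1 q'.2) =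
        {(u, w)} from ?_, sum_singleton]
      · dsimp only at *
        have hw : w ≠ 0 := by
          rintro rfl
          have := hq.2.1
          rw [← e1, add_zero] at this
          omega
        rw [← e1]
        exact sequenceCount_congr _ _ fun x => by rw [h.descends_add hw e3]
      · ext q'
        rw [mem_filter, HasAntidiagonal.mem_antidiagonal, mem_singleton]
        exact ⟨fun hq' => huniq q' hq', fun hq' => by rw [hq']; exact ⟨e1, e2, e3⟩⟩
    rw [sum_congr rfl h1, sum_sigma', sum_sigma']
    refine sum_bij' (fun p _ => ⟨(p.2.1, p.2.2 + p.1.2), (p.2.2, p.1.2)⟩)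
      (fun p _ => ⟨(p.1.1 + p.2.1, p.2.2), (p.1.1, p.2.1)⟩) ?_ ?_ ?_ ?_ ?_
    · rintro ⟨⟨z, v⟩, ⟨u, w⟩⟩ hp
      simp only [mem_sigma, mem_filter, HasAntidiagonal.mem_antidiagonal] at hp ⊢
      obtain ⟨⟨e1, e2, e3⟩, e4, e5, e6⟩ := hp
      subst e4
      rw [h.merge_iff _ _ _ e6] at e3
      rw [map_add] at e2
      rw [add_comm w v]
      exact ⟨⟨by rw [← e1]; abel, e5, e3.2⟩, trivial, ⟨by omega, e3.1⟩, e6⟩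
    · rintro ⟨⟨u, v⟩, ⟨w, v'⟩⟩ hp
      simp only [mem_sigma, mem_filter, HasAntidiagonal.mem_antidiagonal] at hp ⊢
      obtain ⟨⟨e1, e2, e3⟩, e4, ⟨e5, e6⟩, e7⟩ := hp
      subst e4
      rw [h.merge_iff _ _ _ e7, map_add, add_comm v' w]
      exact ⟨⟨by rw [← e1]; abel, by omega, e6, e3⟩, trivial, e2, e7⟩
    · rintro ⟨⟨z, v⟩, ⟨u, w⟩⟩ hp
      simp only [mem_sigma, mem_filter, HasAntidiagonal.mem_antidiagonal] at hp ⊢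
      obtain ⟨-, rfl, -⟩ := hp
      rfl
    · rintro ⟨⟨u, v⟩, ⟨w, v'⟩⟩ hp
      simp only [mem_sigma, mem_filter, HasAntidiagonal.mem_antidiagonal] at hp ⊢
      obtain ⟨-, rfl, -⟩ := hp
      rfl
    · rintro ⟨⟨z, v⟩, ⟨u, w⟩⟩ hp
      rfl
  rw [hmerge, ← sum_add_distrib]
  refine sum_congr rfl fun q _ => ?_
  rw [← sum_filter_add_sum_filter_not ((antidiagonal q.2).filter
    (fun q' => q'.1.degree = b ∧ A q'.2 q'.1)) (fun q' => Descends R q.1 q'.1), filter_filter,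
    filter_filter]
  simp only [and_assoc]

/-- A function of flagged lists that obeys the merging rule after unflagged entries. -/
structure Splits (Φ : List (ℕ × Bool) → ℕ) : Prop where
  merge : ∀ (β : List ℕ) (a b : ℕ) (f : Bool) (L : List (ℕ × Bool)), 0 < b →
    Φ (β.map (·, false) ++ (a, true) :: (b, f) :: L) +
      Φ (β.map (·, false) ++ (a + b, f) :: L) =
      Φ (β.map (·, false) ++ (a, false) :: (b, f) :: L)
  last : ∀ (β : List ℕ) (a : ℕ), Φ (β.map (·, false) ++ [(a, true)]) =
    Φ (β.map (·, false) ++ [(a, false)])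

theorem MergeLaws.splits (h : MergeLaws A R) (r : ℕ →₀ ℕ) :
    Splits fun L => sequenceCount A R L (fun _ => True) r where
  merge β a b f L hb := by
    induction β generalizing r with
    | nil => exact h.sequenceCount_merge a b hb f L r
    | cons c β ih =>
      simp only [List.map_cons, List.cons_append, sequenceCount, Bool.false_eq_true,
        false_implies]
      rw [← sum_add_distrib]
      exact sum_congr rfl fun q _ => ih q.2
  last β a := by
    induction β generalizing r with
    | nil => simp [sequenceCount]
    | cons c β ih =>
      simp only [List.map_cons, List.cons_append, sequenceCount, Bool.false_eq_true,
        false_implies]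
      exact sum_congr rfl fun q _ => ih q.2

theorem Splits.sum {ι : Type*} (s : Finset ι) (k : ι → ℕ) {Φ : ι → List (ℕ × Bool) → ℕ}
    (h : ∀ i, Splits (Φ i)) : Splits fun L => ∑ i ∈ s, Φ i L * k i where
  merge β a b f L hb := by
    rw [← sum_add_distrib]
    exact sum_congr rfl fun i _ => by rw [← (h i).merge β a b f L hb, add_mul]
  last β a := sum_congr rfl fun i _ => by rw [(h i).last]

/-- A flag is removed at the price of a merged list with one entry fewer, so a function obeying the
rule is determined by its values on unflagged lists. The induction keeps a prefix β already free of
flags. -/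
theorem Splits.eq {Φ Ψ : List (ℕ × Bool) → ℕ} (hΦ : Splits Φ) (hΨ : Splits Ψ)
    (h : ∀ β : List ℕ, Φ (β.map (·, false)) = Ψ (β.map (·, false)))
    (L : List (ℕ × Bool)) (hL : ∀ q ∈ L, 0 < q.1) : Φ L = Ψ L := by
  suffices H : ∀ (n : ℕ) (β : List ℕ) (L : List (ℕ × Bool)), L.length = n → (∀ q ∈ L, 0 < q.1) →
      Φ (β.map (·, false) ++ L) = Ψ (β.map (·, false) ++ L) from H _ [] L rfl hL
  intro n
  induction n with
  | zero =>
    intro β L hn _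
    rw [List.length_eq_zero_iff.1 hn, List.append_nil]
    exact h β
  | succ n ih =>
    intro β L hn hpos
    have hff : ∀ (a : ℕ) (L : List (ℕ × Bool)), L.length = n → (∀ q ∈ L, 0 < q.1) →
        Φ (β.map (·, false) ++ (a, false) :: L) = Ψ (β.map (·, false) ++ (a, false) :: L) := by
      intro a L hn hpos
      simpa using ih (β ++ [a]) L hn hpos
    match L, hn, hpos with
    | (a, false) :: L, hn, hpos =>
      exact hff a L (by simpa using hn) fun q hq => hpos q (List.mem_cons_of_mem _ hq)
    | [(a, true)], hn, hpos =>
      rw [hΦ.last, hΨ.last]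
      exact hff a [] (Nat.succ_injective hn) (by simp)
    | (a, true) :: (b, f) :: L, hn, hpos =>
      simp only [List.length_cons, List.mem_cons, forall_eq_or_imp] at hn hpos
      have h1 := hΦ.merge β a b f L hpos.2.1
      have h2 := hΨ.merge β a b f L hpos.2.1
      have h3 := hff a ((b, f) :: L) (by simp only [List.length_cons]; omega)
        (by simpa using hpos.2)
      have h4 : Φ (β.map (·, false) ++ (a + b, f) :: L) =
          Ψ (β.map (·, false) ++ (a + b, f) :: L) := by
        refine ih β ((a + b, f) :: L) (by simp only [List.length_cons]; omega) fun q hq => ?_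
        rcases List.mem_cons.1 hq with rfl | hq
        · exact Nat.add_pos_left hpos.1 b
        · exact hpos.2.2 q hq
      omega

end

end MonotoneRibbon

/-! ### Schur polynomials, the Pieri rule and products of complete polynomials -/

namespace MonotoneRibbon

open Finset

/-- `ν / κ` is a horizontal strip. -/
def Interlaces (κ ν : ℕ →₀ ℕ) : Prop :=
  ∀ i, κ i ≤ ν i ∧ ν (i + 1) ≤ κ i

theorem Interlaces.antitone_left {κ ν : ℕ →₀ ℕ} (h : Interlaces κ ν) : Antitone κ :=
  antitone_nat_of_succ_le fun i => (h (i + 1)).1.trans (h i).2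

theorem Interlaces.antitone_right {κ ν : ℕ →₀ ℕ} (h : Interlaces κ ν) : Antitone ν :=
  antitone_nat_of_succ_le fun i => (h i).2.trans (h i).1

theorem isStrip_iff {v u : ℕ →₀ ℕ} : IsStrip v u ↔ Interlaces v (u + v) := by
  refine forall_congr' fun i => ?_
  simp only [Finsupp.coe_add, Pi.add_apply]
  omega

open Classical in
/-- The partitions of `n`, as antitone functions. -/
noncomputable def partitions (n : ℕ) : Finset (ℕ →₀ ℕ) :=
  {ν ∈ finsuppAntidiag (range n) n | Antitone ν}

theorem mem_partitions {n : ℕ} {ν : ℕ →₀ ℕ} :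
    ν ∈ partitions n ↔ Antitone ν ∧ ν.degree = n := by
  simp only [partitions, mem_filter, mem_finsuppAntidiag]
  rw [and_comm]
  refine and_congr_right fun hν => ⟨fun h => ?_, fun h => ?_⟩
  · rw [degree_eq_sum_range ν (N := n), h.1]
    intro i hi
    by_contra hne
    have := h.2 (Finsupp.mem_support_iff.2 hne)
    simp at this
    omega
  · have h0 : ∀ i, n ≤ i → ν i = 0 := by
      intro i hi
      by_contra hne
      obtain ⟨N, hN⟩ := exists_zero_of_le ν
      have h1 : ∑ j ∈ range (i + 1), 1 ≤ ∑ j ∈ range (i + 1), ν j :=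
        sum_le_sum fun j hj => (Nat.pos_of_ne_zero hne).trans_le
          (hν (Nat.lt_succ_iff.1 (mem_range.1 hj)))
      have h2 : ∑ j ∈ range (i + 1), ν j ≤ ∑ j ∈ range (N + (i + 1)), ν j :=
        sum_le_sum_of_subset (range_mono (by omega))
      rw [← degree_eq_sum_range ν (N := N + (i + 1)) (fun k hk => hN k (by omega)), h] at h2
      rw [sum_const, card_range, smul_eq_mul, mul_one] at h1
      omega
    refine ⟨by rw [← degree_eq_sum_range ν h0, h], fun i hi => ?_⟩
    rw [mem_range]
    by_contra hcon
    exact Finsupp.mem_support_iff.1 hi (h0 i (by omega))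

open Classical in
noncomputable def below (ν : ℕ →₀ ℕ) : Finset (ℕ →₀ ℕ) :=
  {κ ∈ Iic ν | Interlaces κ ν}

theorem mem_below {κ ν : ℕ →₀ ℕ} : κ ∈ below ν ↔ Interlaces κ ν := by
  simp only [below, mem_filter, mem_Iic]
  exact and_iff_right_of_imp fun h i => (h i).1

open Classical in
noncomputable def above (κ : ℕ →₀ ℕ) (b : ℕ) : Finset (ℕ →₀ ℕ) :=
  {ν ∈ partitions (κ.degree + b) | Interlaces κ ν}

theorem mem_above {κ ν : ℕ →₀ ℕ} {b : ℕ} :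
    ν ∈ above κ b ↔ Interlaces κ ν ∧ ν.degree = κ.degree + b := by
  simp only [above, mem_filter, mem_partitions]
  exact ⟨fun h => ⟨h.2, h.1.2⟩, fun h => ⟨⟨h.1.antitone_right, h.2⟩, h.1⟩⟩

open MvPolynomial in
/-- The Schur polynomial of `ν` in the variables `x₀, …, x_{M-1}`, by removing the largest letter. -/
noncomputable def schurPoly : ℕ → (ℕ →₀ ℕ) → MvPolynomial ℕ ℕ
  | 0, ν => if ν = 0 then 1 else 0
  | M + 1, ν => ∑ κ ∈ below ν, schurPoly M κ * X M ^ (ν.degree - κ.degree)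

open MvPolynomial in
/-- The complete homogeneous polynomial of degree `b` in the variables `x₀, …, x_{M-1}`. -/
noncomputable def completePoly : ℕ → ℕ → MvPolynomial ℕ ℕ
  | 0, b => if b = 0 then 1 else 0
  | M + 1, b => ∑ i ∈ range (b + 1), completePoly M (b - i) * X M ^ i

/-- The sum telescopes, since the maximum and the minimum of two numbers add up to their sum. -/
theorem degree_toggle {κ ρ ν τ : ℕ →₀ ℕ} {i : ℕ} (h0 : ν 0 = max (κ 0) (ρ 0) + i)
    (h : ∀ j, ν (j + 1) + τ j = max (κ (j + 1)) (ρ (j + 1)) + min (κ j) (ρ j)) :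
    ν.degree + τ.degree = κ.degree + ρ.degree + i := by
  obtain ⟨N₁, h₁⟩ := exists_zero_of_le κ
  obtain ⟨N₂, h₂⟩ := exists_zero_of_le ρ
  have hκ : ∀ j, N₁ + N₂ ≤ j → κ j = 0 := fun j hj => h₁ j (by omega)
  have hρ : ∀ j, N₁ + N₂ ≤ j → ρ j = 0 := fun j hj => h₂ j (by omega)
  rw [degree_eq_sum_range ν (N := N₁ + N₂ + 1), degree_eq_sum_range τ (N := N₁ + N₂),
    degree_eq_sum_range κ (N := N₁ + N₂ + 1), degree_eq_sum_range ρ (N := N₁ + N₂ + 1)]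
  · have e1 : ∑ j ∈ range (N₁ + N₂), ν (j + 1) + ∑ j ∈ range (N₁ + N₂), τ j =
        ∑ j ∈ range (N₁ + N₂), max (κ (j + 1)) (ρ (j + 1)) +
        ∑ j ∈ range (N₁ + N₂), min (κ j) (ρ j) := by
      rw [← sum_add_distrib, ← sum_add_distrib]
      exact sum_congr rfl fun j _ => h j
    have e2 : ∑ j ∈ range (N₁ + N₂ + 1), max (κ j) (ρ j) +
        ∑ j ∈ range (N₁ + N₂ + 1), min (κ j) (ρ j) =
        ∑ j ∈ range (N₁ + N₂ + 1), κ j + ∑ j ∈ range (N₁ + N₂ + 1), ρ j := by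
      rw [← sum_add_distrib, ← sum_add_distrib]
      exact sum_congr rfl fun j _ => max_add_min _ _
    rw [sum_range_succ' (fun j => max (κ j) (ρ j)), sum_range_succ (fun j => min (κ j) (ρ j)),
      hκ _ le_rfl, min_eq_left (Nat.zero_le _)] at e2
    rw [sum_range_succ' ν, h0]
    omega
  · exact fun j hj => hρ j (by omega)
  · exact fun j hj => hκ j (by omega)
  · intro j hj
    have := h j
    rw [hκ j hj, hκ (j + 1) (by omega), hρ j hj, hρ (j + 1) (by omega)] at this
    simp at this
    exact this.2
  · rintro (_ | j) hj
    · omega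
    · have := h j
      rw [hκ j (by omega), hκ (j + 1) (by omega), hρ j (by omega), hρ (j + 1) (by omega)] at this
      simp at this
      exact this.1

/-- The partition below `κ` and `ρ` that corresponds to `ν` above them. -/
noncomputable def toggleDown (κ ρ ν : ℕ →₀ ℕ) : ℕ →₀ ℕ :=
  Finsupp.onFinset κ.support
    (fun j => min (κ j) (ρ j) - (ν (j + 1) - max (κ (j + 1)) (ρ (j + 1)))) fun j hj => by
      rw [Finsupp.mem_support_iff]; intro h; rw [h] at hj; simp at hj

/-- The partition above `κ` and `ρ` that corresponds to `τ` below them and to `i` new boxes in the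
first row. -/
noncomputable def toggleUp (κ ρ τ : ℕ →₀ ℕ) (i : ℕ) : ℕ →₀ ℕ :=
  Finsupp.onFinset (insert 0 (κ.support ∪ ρ.support ∪ κ.support.image Nat.succ))
    (fun j => max (κ j) (ρ j) + if j = 0 then i else min (κ (j - 1)) (ρ (j - 1)) - τ (j - 1))
    fun j hj => by
      rcases j with _ | j
      · simp
      · simp only [mem_insert, mem_union, Finsupp.mem_support_iff, mem_image]
        by_contra! hcon
        have h3 : κ j = 0 := by
          by_contra h
          exact hcon.2.2 j h rfl
        simp [hcon.2.1.1, hcon.2.1.2, h3] at hj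

/-- Given κ and ρ, the entry ν (j + 1) above them and the entry τ j below them range over the same
interval, from max (κ (j + 1)) (ρ (j + 1)) to min (κ j) (ρ j). Reflecting this interval exchanges
them; only ν 0 is unbounded above. -/
theorem interlaces_toggleDown {κ ρ ν : ℕ →₀ ℕ} (hκ : Interlaces κ ν) (hρ : Interlaces ρ ν) :
    Interlaces (toggleDown κ ρ ν) κ ∧ Interlaces (toggleDown κ ρ ν) ρ ∧
      ∀ j, ν (j + 1) + toggleDown κ ρ ν j = max (κ (j + 1)) (ρ (j + 1)) + min (κ j) (ρ j) := by
  simp only [Interlaces, toggleDown, Finsupp.onFinset_apply, ← forall_and]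
  intro j
  have h1 := hκ j
  have h2 := hρ j
  have h3 := hκ (j + 1)
  have h4 := hρ (j + 1)
  omega

theorem interlaces_toggleUp {κ ρ τ : ℕ →₀ ℕ} (i : ℕ) (hκ : Interlaces τ κ) (hρ : Interlaces τ ρ) :
    Interlaces κ (toggleUp κ ρ τ i) ∧ Interlaces ρ (toggleUp κ ρ τ i) ∧
      toggleUp κ ρ τ i 0 = max (κ 0) (ρ 0) + i ∧
      ∀ j, toggleUp κ ρ τ i (j + 1) + τ j =
        max (κ (j + 1)) (ρ (j + 1)) + min (κ j) (ρ j) := by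
  refine ⟨fun j => ⟨?_, ?_⟩, fun j => ⟨?_, ?_⟩, ?_, fun j => ?_⟩
  · simp only [toggleUp, Finsupp.onFinset_apply]; omega
  · have h1 := hκ j
    have h2 := hρ j
    simp only [toggleUp, Finsupp.onFinset_apply, Nat.add_eq_zero_iff, one_ne_zero, and_false,
      if_false, Nat.add_sub_cancel]
    omega
  · simp only [toggleUp, Finsupp.onFinset_apply]; omega
  · have h1 := hκ j
    have h2 := hρ j
    simp only [toggleUp, Finsupp.onFinset_apply, Nat.add_eq_zero_iff, one_ne_zero, and_false,
      if_false, Nat.add_sub_cancel]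
    omega
  · simp [toggleUp]
  · have h1 := hκ j
    have h2 := hρ j
    simp only [toggleUp, Finsupp.onFinset_apply, Nat.add_eq_zero_iff, one_ne_zero, and_false,
      if_false, Nat.add_sub_cancel]
    omega

theorem Interlaces.degree_le {κ ν : ℕ →₀ ℕ} (h : Interlaces κ ν) : κ.degree ≤ ν.degree :=
  Finsupp.degree_mono fun i => (h i).1

/-- The Pieri rule. -/
theorem sum_above_schurPoly (M : ℕ) (κ : ℕ →₀ ℕ) (b : ℕ) :
    ∑ ν ∈ above κ b, schurPoly M ν = completePoly M b * schurPoly M κ := by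
  induction M generalizing κ b with
  | zero =>
    simp only [schurPoly, completePoly]
    rw [sum_ite_eq']
    by_cases h : κ = 0 ∧ b = 0
    · obtain ⟨rfl, rfl⟩ := h
      rw [if_pos (mem_above.2 ⟨fun i => by simp, by simp⟩)]
      simp
    · rw [if_neg]
      · rcases not_and_or.1 h with h | h <;> simp [h]
      · rw [mem_above]
        rintro ⟨h1, h2⟩
        rw [map_zero] at h2
        exact h ⟨Finsupp.degree_eq_zero_iff _ |>.1 (by omega), by omega⟩
  | succ M ih =>
    simp only [schurPoly, completePoly]
    rw [sum_mul_sum]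
    have hR : ∀ i ∈ range (b + 1), ∀ τ ∈ below κ,
        completePoly M (b - i) * MvPolynomial.X M ^ i *
          (schurPoly M τ * MvPolynomial.X M ^ (κ.degree - τ.degree)) =
        ∑ ρ ∈ above τ (b - i), schurPoly M ρ * MvPolynomial.X M ^ (κ.degree - τ.degree + i) := by
      intro i _ τ _
      rw [← sum_mul, ih, pow_add]
      ring
    rw [sum_congr rfl fun i hi => sum_congr rfl (hR i hi), ← sum_product', sum_sigma', sum_sigma']
    -- The local rule of the Robinson–Schensted–Knuth correspondence: ρ is kept, ν is exchanged for
    -- τ, and the excess of ν 0 over the maximum becomes the exponent taken from the complete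
    -- polynomial.
    refine sum_bij' (fun p _ => ⟨(p.1 0 - max (κ 0) (p.2 0), toggleDown κ p.2 p.1), p.2⟩)
      (fun p _ => ⟨toggleUp κ p.2 p.1.2 p.1.1, p.2⟩) ?_ ?_ ?_ ?_ ?_
    · rintro ⟨ν, ρ⟩ hp
      simp only [mem_sigma, mem_above, mem_below] at hp
      obtain ⟨⟨h1, h2⟩, h3⟩ := hp
      obtain ⟨e1, e2, e3⟩ := interlaces_toggleDown h1 h3
      have e4 := degree_toggle (i := ν 0 - max (κ 0) (ρ 0))
        (by have := (h1 0).1; have := (h3 0).1; omega) e3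
      have e5 := e2.degree_le
      simp only [mem_sigma, mem_product, mem_range, mem_below, mem_above]
      exact ⟨⟨by omega, e1⟩, e2, by omega⟩
    · rintro ⟨⟨i, τ⟩, ρ⟩ hp
      simp only [mem_sigma, mem_product, mem_range, mem_below, mem_above] at hp
      obtain ⟨⟨h1, h2⟩, h3, h4⟩ := hp
      obtain ⟨e1, e2, e3, e4⟩ := interlaces_toggleUp i h2 h3
      have e5 := degree_toggle e3 e4
      simp only [mem_sigma, mem_above, mem_below]
      exact ⟨⟨e1, by omega⟩, e2⟩
    · rintro ⟨ν, ρ⟩ hp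
      simp only [mem_sigma, mem_above, mem_below] at hp
      obtain ⟨⟨h1, h2⟩, h3⟩ := hp
      obtain ⟨e1, e2, e3⟩ := interlaces_toggleDown h1 h3
      obtain ⟨-, -, e4, e5⟩ := interlaces_toggleUp (ν 0 - max (κ 0) (ρ 0)) e1 e2
      congr 1
      ext j
      rcases j with _ | j
      · rw [e4]
        have := (h1 0).1
        have := (h3 0).1
        omega
      · have := e3 j
        have := e5 j
        dsimp only
        omega
    · rintro ⟨⟨i, τ⟩, ρ⟩ hp
      simp only [mem_sigma, mem_product, mem_range, mem_below, mem_above] at hp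
      obtain ⟨⟨h1, h2⟩, h3, h4⟩ := hp
      obtain ⟨e1, e2, e3, e4⟩ := interlaces_toggleUp i h2 h3
      obtain ⟨-, -, e5⟩ := interlaces_toggleDown e1 e2
      congr 2
      · dsimp only
        omega
      · ext j
        have := e4 j
        have := e5 j
        dsimp only
        omega
    · rintro ⟨ν, ρ⟩ hp
      simp only [mem_sigma, mem_above, mem_below] at hp
      obtain ⟨⟨h1, h2⟩, h3⟩ := hp
      obtain ⟨e1, e2, e3⟩ := interlaces_toggleDown h1 h3
      have e4 := degree_toggle (i := ν 0 - max (κ 0) (ρ 0))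
        (by have := (h1 0).1; have := (h3 0).1; omega) e3
      have e5 := e1.degree_le
      have e6 := h3.degree_le
      dsimp only
      congr 2
      omega

/-- The Cauchy identity, in the form of an expansion of a product of complete polynomials. -/
theorem sum_sequenceCount_schurPoly (M : ℕ) (β : List ℕ) :
    ∑ ν ∈ partitions β.sum,
        sequenceCount IsStrip (· > ·) (β.map (·, false)) (fun _ => True) ν • schurPoly M ν =
      (β.map (completePoly M)).prod := by
  classical
  induction β with
  | nil =>
    rw [List.sum_nil, show partitions 0 = {0} from ?_]
    · simp only [List.map_nil, sequenceCount, sum_singleton, if_true, one_smul, List.prod_nil]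
      induction M with
      | zero => simp [schurPoly]
      | succ M ih =>
        rw [schurPoly, show below 0 = {0} from ?_]
        · simp [ih]
        · ext κ
          rw [mem_below, mem_singleton]
          refine ⟨fun h => ?_, ?_⟩
          · ext i
            exact Nat.le_zero.1 (h i).1
          · rintro rfl i
            simp
    · ext ν
      rw [mem_partitions, mem_singleton, Finsupp.degree_eq_zero_iff]
      refine ⟨And.right, ?_⟩
      rintro rfl
      exact ⟨fun _ _ _ => le_rfl, rfl⟩
  | cons a β ih =>
    rw [List.map_cons (f := completePoly M), List.prod_cons, ← ih, mul_sum]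
    simp only [List.map_cons, sequenceCount, and_true, Bool.false_eq_true, false_implies,
      sum_smul, mul_smul_comm, ← sum_above_schurPoly, smul_sum]
    rw [sum_sigma', sum_sigma']
    refine sum_bij' (fun p _ => ⟨p.2.2, p.1⟩) (fun p _ => ⟨p.2, (p.2 - p.1, p.1)⟩) ?_ ?_ ?_ ?_ ?_
    · rintro ⟨ν, u, v⟩ hp
      simp only [mem_sigma, mem_filter, HasAntidiagonal.mem_antidiagonal, mem_partitions,
        mem_above] at hp ⊢
      obtain ⟨⟨h1, h2⟩, rfl, h3, h4⟩ := hp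
      rw [isStrip_iff] at h4
      rw [map_add, List.sum_cons] at h2
      rw [map_add]
      exact ⟨⟨h4.antitone_left, by omega⟩, h4, by omega⟩
    · rintro ⟨v, ν⟩ hp
      simp only [mem_sigma, mem_filter, HasAntidiagonal.mem_antidiagonal, mem_partitions,
        mem_above] at hp ⊢
      obtain ⟨⟨h1, h2⟩, h3, h4⟩ := hp
      have h5 : ν - v + v = ν := tsub_add_cancel_of_le fun i => (h3 i).1
      have h6 := congrArg Finsupp.degree h5
      rw [map_add] at h6
      rw [isStrip_iff, h5, List.sum_cons]
      exact ⟨⟨h3.antitone_right, by omega⟩, rfl, by omega, h3⟩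
    · rintro ⟨ν, u, v⟩ hp
      simp only [mem_sigma, mem_filter, HasAntidiagonal.mem_antidiagonal] at hp ⊢
      obtain ⟨-, rfl, -⟩ := hp
      rw [add_tsub_cancel_right]
    · rintro ⟨v, ν⟩ _
      rfl
    · rintro ⟨ν, u, v⟩ _
      rfl

/-! ### Coefficients, extracted one variable at a time -/

/-- A polynomial in the variables `x₀, …, x_{M-1}`. -/
def InVars (M : ℕ) (f : MvPolynomial ℕ ℕ) : Prop :=
  ∀ m, f.coeff m ≠ 0 → ∀ x, M ≤ x → m x = 0

theorem InVars.coeff_mul_X_pow {M : ℕ} {f : MvPolynomial ℕ ℕ} (hf : InVars M f) (i : ℕ)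
    (m : ℕ →₀ ℕ) : (f * MvPolynomial.X M ^ i).coeff m =
      if m M = i then f.coeff (m.erase M) else 0 := by
  rw [MvPolynomial.X_pow_eq_monomial, MvPolynomial.coeff_mul_monomial', mul_one]
  by_cases h : m M = i
  · subst h
    have h1 : Finsupp.single M (m M) ≤ m := by simp
    rw [if_pos h1, if_pos rfl]
    congr 1
    ext x
    by_cases hx : x = M
    · subst hx; simp
    · simp [hx]
  · rw [if_neg h]
    split_ifs with h1
    · by_contra hne
      have := hf _ hne M le_rfl
      rw [Finsupp.single_le_iff] at h1
      simp at this
      omega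
    · rfl

theorem InVars.mul_X_pow {M : ℕ} {f : MvPolynomial ℕ ℕ} (hf : InVars M f) (i : ℕ) :
    InVars (M + 1) (f * MvPolynomial.X M ^ i) := by
  intro m hm x hx
  rw [hf.coeff_mul_X_pow] at hm
  split_ifs at hm with h
  · have := hf _ hm x (by omega)
    rwa [Finsupp.erase_ne (by omega)] at this
  · exact absurd rfl hm

theorem InVars.sum {ι : Type*} {M : ℕ} (s : Finset ι) {f : ι → MvPolynomial ℕ ℕ}
    (hf : ∀ i ∈ s, InVars M (f i)) : InVars M (∑ i ∈ s, f i) := by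
  intro m hm x hx
  rw [MvPolynomial.coeff_sum] at hm
  obtain ⟨i, hi, hne⟩ := exists_ne_zero_of_sum_ne_zero hm
  exact hf i hi m hne x hx

theorem inVars_ite (p : Prop) [Decidable p] : InVars 0 (if p then 1 else 0) := by
  intro m hm x _
  split_ifs at hm
  · rw [MvPolynomial.coeff_one] at hm
    by_cases h : 0 = m
    · rw [← h]; rfl
    · simp [h] at hm
  · simp at hm

theorem inVars_schurPoly (M : ℕ) (ν : ℕ →₀ ℕ) : InVars M (schurPoly M ν) := by
  induction M generalizing ν with
  | zero => exact inVars_ite _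
  | succ M ih => exact InVars.sum _ fun κ _ => (ih κ).mul_X_pow _

theorem inVars_completePoly (M b : ℕ) : InVars M (completePoly M b) := by
  induction M generalizing b with
  | zero => exact inVars_ite _
  | succ M ih => exact InVars.sum _ fun i _ => (ih _).mul_X_pow _

theorem degree_erase_add (m : ℕ →₀ ℕ) (x : ℕ) : (m.erase x).degree + m x = m.degree := by
  conv_rhs => rw [← Finsupp.erase_add_single x m]
  rw [map_add, Finsupp.degree_single]

theorem coeff_completePoly (M b : ℕ) (m : ℕ →₀ ℕ) (hm : ∀ x, M ≤ x → m x = 0) :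
    (completePoly M b).coeff m = if m.degree = b then 1 else 0 := by
  induction M generalizing b m with
  | zero =>
    have : m = 0 := by ext x; exact hm x (Nat.zero_le x)
    subst this
    by_cases hb : b = 0
    · simp [completePoly, hb]
    · simp [completePoly, hb, Ne.symm hb]
  | succ M ih =>
    rw [completePoly, MvPolynomial.coeff_sum]
    have h1 : ∀ i ∈ range (b + 1), (completePoly M (b - i) * MvPolynomial.X M ^ i).coeff m =
        if m M = i then (if (m.erase M).degree = b - i then 1 else 0) else 0 := by
      intro i _
      rw [(inVars_completePoly M _).coeff_mul_X_pow, ih]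
      intro x hx
      by_cases hxM : x = M
      · subst hxM; simp
      · rw [Finsupp.erase_ne hxM]; exact hm x (by omega)
    rw [sum_congr rfl h1, sum_ite_eq]
    have h2 := degree_erase_add m M
    simp only [mem_range]
    split_ifs <;> omega

/-- The number of words with given row sizes and contents. -/
theorem coeff_prod_completePoly (M : ℕ) (β : List ℕ) (m : ℕ →₀ ℕ) (hm : ∀ x, M ≤ x → m x = 0) :
    (β.map (completePoly M)).prod.coeff m =
      sequenceCount (fun _ _ => True) (· < ·) (β.map (·, false)) (fun _ => True) m := by
  classical
  induction β generalizing m with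
  | nil => simp [sequenceCount, MvPolynomial.coeff_one, eq_comm]
  | cons a β ih =>
    simp only [List.map_cons, List.prod_cons, sequenceCount, MvPolynomial.coeff_mul, and_true,
      Bool.false_eq_true, false_implies]
    rw [sum_filter]
    refine sum_congr rfl fun q hq => ?_
    rw [HasAntidiagonal.mem_antidiagonal] at hq
    have h1 : ∀ x, M ≤ x → q.1 x = 0 ∧ q.2 x = 0 := fun x hx => by
      have := hm x hx
      rw [← hq] at this
      simpa using this
    rw [coeff_completePoly M a q.1 fun x hx => (h1 x hx).1, ih q.2 fun x hx => (h1 x hx).2,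
      ite_mul, one_mul, zero_mul]

end MonotoneRibbon

/-! ### Semistandard tableaux and the coefficients of Schur polynomials -/

namespace MonotoneRibbon

open Finset

/-- Counting along a map to a finite set. -/
theorem finite_and_card_of_fibers {X ι Y : Type*} {P : X → Prop} {Q : ι → Y → Prop}
    (S : Finset ι) (n : ι → ℕ) (f : X → ι × Y) (g : ι × Y → X)
    (hf : ∀ x, P x → (f x).1 ∈ S ∧ Q (f x).1 (f x).2 ∧ g (f x) = x)
    (hg : ∀ i y, i ∈ S → Q i y → P (g (i, y)) ∧ f (g (i, y)) = (i, y))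
    (hn : ∀ i ∈ S, Finite {y // Q i y} ∧ Nat.card {y // Q i y} = n i) :
    Finite {x // P x} ∧ Nat.card {x // P x} = ∑ i ∈ S, n i := by
  let e : {x // P x} ≃ Σ i : S, {y // Q i y} :=
    { toFun := fun x => ⟨⟨(f x.1).1, (hf x.1 x.2).1⟩, ⟨(f x.1).2, (hf x.1 x.2).2.1⟩⟩
      invFun := fun p => ⟨g (p.1.1, p.2.1), (hg p.1.1 p.2.1 p.1.2 p.2.2).1⟩
      left_inv := fun x => Subtype.ext (hf x.1 x.2).2.2
      right_inv := by
        rintro ⟨⟨i, hi⟩, ⟨y, hy⟩⟩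
        have h1 := (hg i y hi hy).2
        have key : ∀ (q : ι × Y) (h1 : q.1 ∈ S) (h2 : Q q.1 q.2), q = (i, y) →
            (⟨⟨q.1, h1⟩, ⟨q.2, h2⟩⟩ : Σ i : S, {y // Q i y}) = ⟨⟨i, hi⟩, ⟨y, hy⟩⟩ := by
          rintro q h1 h2 rfl; rfl
        exact key _ _ _ h1 }
  have : ∀ i : S, Finite {y // Q i y} := fun i => (hn i.1 i.2).1
  refine ⟨Finite.of_equiv _ e.symm, ?_⟩
  rw [Nat.card_congr e, Nat.card_sigma, ← sum_coe_sort S n]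
  exact sum_congr rfl fun i _ => (hn i.1 i.2).2

/-- The members of an initial segment are counted off. -/
theorem lt_card_filter_iff {n : ℕ} {p : ℕ → Prop} [DecidablePred p]
    (h : ∀ c₁ c₂, c₁ < c₂ → c₂ < n → p c₂ → p c₁) (c : ℕ) :
    c < ((range n).filter p).card ↔ c < n ∧ p c := by
  induction n with
  | zero => simp
  | succ n ih =>
    have ih' := ih fun c₁ c₂ h1 h2 => h c₁ c₂ h1 (by omega)
    rw [range_add_one, filter_insert]
    by_cases hp : p n
    · have hall : (range n).filter p = range n :=
        filter_true_of_mem fun x hx => h x n (mem_range.1 hx) (Nat.lt_succ_self n) hp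
      rw [if_pos hp, hall, card_insert_of_notMem (by simp), card_range]
      refine ⟨fun hc => ⟨hc, ?_⟩, fun hc => hc.1⟩
      rcases eq_or_lt_of_le (Nat.lt_succ_iff.1 hc) with rfl | hlt
      · exact hp
      · exact h c n hlt (Nat.lt_succ_self n) hp
    · rw [if_neg hp, ih']
      refine and_congr_left fun hc => ⟨fun h => by omega, fun h => ?_⟩
      refine lt_of_le_of_ne (Nat.lt_succ_iff.1 h) ?_
      rintro rfl
      exact hp hc

/-- A filling of the straight shape `ν` that is a semistandard tableau. -/
structure IsTableau (ν : ℕ →₀ ℕ) (e : ℕ → ℕ → ℕ) : Prop where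
  row_weak : ∀ r c₁ c₂, c₁ < c₂ → c₂ < ν r → e r c₁ ≤ e r c₂
  col_strict : ∀ r₁ r₂ c, r₁ < r₂ → c < ν r₁ → c < ν r₂ → e r₁ c < e r₂ c
  zeros : ∀ r c, ν r ≤ c → e r c = 0

/-- The content of a filling of the straight shape `ν`. -/
noncomputable def content (ν : ℕ →₀ ℕ) (e : ℕ → ℕ → ℕ) : ℕ →₀ ℕ :=
  ∑ r ∈ ν.support, ∑ c ∈ range (ν r), Finsupp.single (e r c) 1

theorem content_eq_sum_range {ν : ℕ →₀ ℕ} (e : ℕ → ℕ → ℕ) {N : ℕ} (hN : ∀ i, N ≤ i → ν i = 0) :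
    content ν e = ∑ r ∈ range N, ∑ c ∈ range (ν r), Finsupp.single (e r c) 1 := by
  refine sum_subset (fun r hr => ?_) fun r _ hr => ?_
  · rw [mem_range]
    by_contra h
    exact Finsupp.mem_support_iff.1 hr (hN r (by omega))
  · rw [Finsupp.notMem_support_iff.1 hr]; simp

theorem content_ne_zero {ν : ℕ →₀ ℕ} (e : ℕ → ℕ → ℕ) {r c : ℕ} (hc : c < ν r) :
    content ν e (e r c) ≠ 0 := by
  have h1 : Finsupp.single (e r c) 1 ≤ content ν e := by
    refine le_trans ?_ (single_le_sum (f := fun r => ∑ c ∈ range (ν r), Finsupp.single (e r c) 1)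
      (fun _ _ => zero_le) (Finsupp.mem_support_iff.2 (show ν r ≠ 0 by omega)))
    exact single_le_sum (f := fun c => Finsupp.single (e r c) 1)
      (fun _ _ => zero_le) (mem_range.2 hc)
  have := h1 (e r c)
  rw [Finsupp.single_eq_same] at this
  omega

/-- The shape of the entries less than `M`. -/
noncomputable def shapeBelow (M : ℕ) (ν : ℕ →₀ ℕ) (e : ℕ → ℕ → ℕ) : ℕ →₀ ℕ :=
  Finsupp.onFinset ν.support (fun r => ((range (ν r)).filter fun c => e r c < M).card)
    fun r hr => by
      rw [Finsupp.mem_support_iff]; intro h; rw [h] at hr; simp at hr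

theorem IsTableau.lt_shapeBelow {ν : ℕ →₀ ℕ} {e : ℕ → ℕ → ℕ} (h : IsTableau ν e) (M r c : ℕ) :
    c < shapeBelow M ν e r ↔ c < ν r ∧ e r c < M :=
  lt_card_filter_iff (p := fun c => e r c < M)
    (fun c₁ c₂ h1 h2 h3 => (h.row_weak r c₁ c₂ h1 h2).trans_lt h3) c

theorem content_split {M : ℕ} {κ ν : ℕ →₀ ℕ} (hκ : κ ≤ ν) {e e' : ℕ → ℕ → ℕ}
    (h1 : ∀ r c, c < κ r → e r c = e' r c) (h2 : ∀ r c, κ r ≤ c → c < ν r → e r c = M) :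
    content ν e = content κ e' + Finsupp.single M (ν.degree - κ.degree) := by
  obtain ⟨N, hN⟩ := exists_zero_of_le ν
  have hN' : ∀ i, N ≤ i → κ i = 0 := fun i hi => Nat.le_zero.1 (hN i hi ▸ hκ i)
  rw [content_eq_sum_range e hN, content_eq_sum_range e' hN']
  have hdeg : ν.degree - κ.degree = ∑ r ∈ range N, (ν r - κ r) := by
    rw [degree_eq_sum_range ν hN, degree_eq_sum_range κ hN',
      sum_tsub_distrib _ fun r _ => hκ r]
  rw [hdeg, Finsupp.single_finsetSum, ← sum_add_distrib]
  refine sum_congr rfl fun r _ => ?_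
  rw [← sum_range_add_sum_Ico _ (hκ r)]
  congr 1
  · exact sum_congr rfl fun c hc => by rw [h1 r c (mem_range.1 hc)]
  · rw [sum_congr rfl (g := fun _ => Finsupp.single M 1) fun c hc => by
      rw [h2 r c (mem_Ico.1 hc).1 (mem_Ico.1 hc).2]]
    simp

/-- The coefficients of Schur polynomials count semistandard tableaux. -/
theorem card_tableaux (M : ℕ) (ν m : ℕ →₀ ℕ) (hν : Antitone ν) (hm : ∀ x, M ≤ x → m x = 0) :
    Finite {e // IsTableau ν e ∧ content ν e = m} ∧
      Nat.card {e // IsTableau ν e ∧ content ν e = m} = (schurPoly M ν).coeff m := by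
  induction M generalizing ν m with
  | zero =>
    have hm0 : m = 0 := by ext x; exact hm x (Nat.zero_le x)
    subst hm0
    by_cases h : ν = 0
    · subst h
      have : Unique {e // IsTableau 0 e ∧ content 0 e = 0} :=
        { default := ⟨fun _ _ => 0, ⟨by simp, by simp, by simp⟩, by simp [content]⟩
          uniq := fun e => Subtype.ext (funext fun r => funext fun c =>
            e.2.1.zeros r c (Nat.zero_le c)) }
      refine ⟨inferInstance, ?_⟩
      rw [Nat.card_unique]
      simp [schurPoly]
    · have : IsEmpty {e // IsTableau ν e ∧ content ν e = 0} := by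
        refine ⟨fun e => ?_⟩
        obtain ⟨r, hr⟩ := DFunLike.ne_iff.1 h
        have hr' : ν r ≠ 0 := hr
        have := content_ne_zero (ν := ν) e.1 (r := r) (c := 0) (by omega)
        rw [e.2.2] at this
        exact this rfl
      refine ⟨inferInstance, ?_⟩
      rw [Nat.card_eq_zero.2 (Or.inl this)]
      simp [schurPoly, h]
  | succ M ih =>
    classical
    have hcoeff : (schurPoly (M + 1) ν).coeff m =
        ∑ κ ∈ below ν with m M = ν.degree - κ.degree, (schurPoly M κ).coeff (m.erase M) := by
      rw [schurPoly, MvPolynomial.coeff_sum, sum_filter]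
      exact sum_congr rfl fun κ _ => (inVars_schurPoly M κ).coeff_mul_X_pow _ _
    have herase : ∀ x, M ≤ x → m.erase M x = 0 := fun x hx => by
      by_cases hxM : x = M
      · subst hxM; simp
      · rw [Finsupp.erase_ne hxM]; exact hm x (by omega)
    rw [hcoeff]
    -- A tableau with letters at most M is a tableau with letters below M, of some shape κ, together
    -- with the strip ν / κ filled with M.
    refine finite_and_card_of_fibers (Q := fun κ e => IsTableau κ e ∧ content κ e = m.erase M)
      _ _ (fun e => (shapeBelow M ν e, fun r c => if c < shapeBelow M ν e r then e r c else 0))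
      (fun p r c => if c < p.1 r then p.2 r c else if c < ν r then M else 0) ?_ ?_ ?_
    · rintro e ⟨he, hem⟩
      have hle : ∀ r c, c < ν r → e r c ≤ M := fun r c hc => by
        by_contra hcon
        exact content_ne_zero e hc (by rw [hem]; exact hm _ (by omega))
      have hκ := he.lt_shapeBelow M
      have hsub : ∀ r, shapeBelow M ν e r ≤ ν r := fun r => by
        by_contra! hcon
        exact lt_irrefl _ ((hκ r _).1 hcon).1
      -- A box of row r + 1 beyond the small entries of row r would lie under an entry equal to M
      -- and so exceed M.
      have hinter : Interlaces (shapeBelow M ν e) ν := by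
        refine fun r => ⟨hsub r, ?_⟩
        by_contra! hcon
        have h1 := hle (r + 1) _ hcon
        have h2 := hcon.trans_le (hν (Nat.le_succ r))
        have h3 := he.col_strict r (r + 1) _ (Nat.lt_succ_self r) h2 hcon
        exact lt_irrefl _ ((hκ r _).2 ⟨h2, by omega⟩)
      have hbig : ∀ r c, shapeBelow M ν e r ≤ c → c < ν r → e r c = M := by
        intro r c h1 h2
        by_contra hne
        have := (hκ r c).2 ⟨h2, by have := hle r c h2; omega⟩
        omega
      have hsplit := content_split (M := M) (κ := shapeBelow M ν e) (ν := ν) (e := e)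
        (e' := fun r c => if c < shapeBelow M ν e r then e r c else 0) hsub
        (fun r c hc => by rw [if_pos hc]) hbig
      have hzero : content (shapeBelow M ν e)
          (fun r c => if c < shapeBelow M ν e r then e r c else 0) M = 0 := by
        simp only [content, Finsupp.finsetSum_apply]
        refine sum_eq_zero fun r _ => sum_eq_zero fun c hc => ?_
        rw [mem_range] at hc
        rw [if_pos hc, Finsupp.single_apply, if_neg]
        have := ((hκ r c).1 hc).2
        omega
      rw [hem] at hsplit
      refine ⟨?_, ⟨⟨?_, ?_, ?_⟩, ?_⟩, ?_⟩
      · rw [mem_filter, mem_below]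
        refine ⟨hinter, ?_⟩
        rw [hsplit]
        simp [hzero]
      · intro r c₁ c₂ h1 h2
        dsimp only at *
        rw [if_pos h2, if_pos (h1.trans h2)]
        exact he.row_weak r c₁ c₂ h1 (h2.trans_le (hsub r))
      · intro r₁ r₂ c h1 h2 h3
        dsimp only at *
        rw [if_pos h2, if_pos h3]
        exact he.col_strict r₁ r₂ c h1 (h2.trans_le (hsub _)) (h3.trans_le (hsub _))
      · intro r c h1
        exact if_neg (by dsimp only at h1; omega)
      · dsimp only
        rw [hsplit]
        ext x
        by_cases hx : x = M
        · subst hx; rw [hzero, Finsupp.erase_same]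
        · rw [Finsupp.erase_ne hx]
          simp [Ne.symm hx]
      · funext r c
        dsimp only
        split_ifs with h1 h2
        · rfl
        · exact (hbig r c (by omega) h2).symm
        · exact (he.zeros r c (by omega)).symm
    · rintro κ e hκ ⟨he, hem⟩
      rw [mem_filter, mem_below] at hκ
      obtain ⟨hκ, hdeg⟩ := hκ
      have hsub : κ ≤ ν := fun i => (hκ i).1
      have hlt : ∀ r c, c < κ r → e r c < M := fun r c hc => by
        by_contra hcon
        exact content_ne_zero e hc (by rw [hem]; exact herase _ (by omega))
      have hT : IsTableau ν (fun r c => if c < κ r then e r c else if c < ν r then M else 0) := by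
        refine ⟨fun r c₁ c₂ h1 h2 => ?_, fun r₁ r₂ c h1 h2 h3 => ?_, fun r c h1 => ?_⟩
        · by_cases h4 : c₂ < κ r
          · rw [if_pos h4, if_pos (h1.trans h4)]
            exact he.row_weak r c₁ c₂ h1 h4
          · rw [if_neg h4, if_pos h2]
            split_ifs with h5 h6
            · exact (hlt r c₁ h5).le
            · exact le_rfl
            · exact Nat.zero_le M
        · have h4 : c < κ r₁ := h3.trans_le ((hν (Nat.succ_le_of_lt h1)).trans (hκ r₁).2)
          rw [if_pos h4]
          by_cases h5 : c < κ r₂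
          · rw [if_pos h5]
            exact he.col_strict r₁ r₂ c h1 h4 h5
          · rw [if_neg h5, if_pos h3]
            exact hlt r₁ c h4
        · have := hsub r
          rw [if_neg (by omega), if_neg (by omega)]
      have hsplit := content_split (M := M) (κ := κ) (ν := ν)
        (e := fun r c => if c < κ r then e r c else if c < ν r then M else 0) (e' := e) hsub
        (fun r c hc => by rw [if_pos hc])
        (fun r c h1 h2 => by rw [if_neg (by omega), if_pos h2])
      have hshape : shapeBelow M ν
          (fun r c => if c < κ r then e r c else if c < ν r then M else 0) = κ := by
        ext r
        refine eq_of_forall_lt_iff fun c => ?_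
        rw [hT.lt_shapeBelow]
        refine ⟨fun ⟨h1, h2⟩ => ?_, fun h1 => ⟨h1.trans_le (hsub r), ?_⟩⟩
        · by_contra hcon
          rw [if_neg hcon, if_pos h1] at h2
          exact lt_irrefl _ h2
        · rw [if_pos h1]; exact hlt r c h1
      refine ⟨⟨hT, ?_⟩, ?_⟩
      · dsimp only
        rw [hsplit, hem, ← hdeg, Finsupp.erase_add_single]
      · dsimp only
        rw [hshape]
        refine Prod.ext rfl (funext fun r => funext fun c => ?_)
        dsimp only
        split_ifs with h1
        · rfl
        · exact (he.zeros r c (by omega)).symm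
    · intro κ hκ
      rw [mem_filter, mem_below] at hκ
      exact ih κ (m.erase M) hκ.1.antitone_left herase

/-- The row lengths of a diagram. -/
noncomputable def rows (ν : YoungDiagram) : ℕ →₀ ℕ :=
  Finsupp.onFinset (range (ν.colLen 0)) ν.rowLen fun r hr => by
    rw [mem_range, ← YoungDiagram.mem_iff_lt_colLen, YoungDiagram.mem_iff_lt_rowLen]
    exact Nat.pos_of_ne_zero hr

@[simp]
theorem rows_apply (ν : YoungDiagram) (r : ℕ) : rows ν r = ν.rowLen r := rfl

theorem rows_antitone (ν : YoungDiagram) : Antitone (rows ν) := fun _ _ h => ν.rowLen_anti _ _ h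

theorem mem_skewCells {lam mu : YoungDiagram} {r c : ℕ} :
    (r, c) ∈ skewCells lam mu ↔ mu.rowLen r ≤ c ∧ c < lam.rowLen r := by
  rw [skewCells, mem_sdiff, YoungDiagram.mem_cells, YoungDiagram.mem_cells,
    YoungDiagram.mem_iff_lt_rowLen, YoungDiagram.mem_iff_lt_rowLen]
  omega

theorem rowLen_bot (r : ℕ) : (⊥ : YoungDiagram).rowLen r = 0 := by
  by_contra h
  exact YoungDiagram.notMem_bot (r, 0) (YoungDiagram.mem_iff_lt_rowLen.2 (Nat.pos_of_ne_zero h))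

theorem rowLen_eq_zero (ν : YoungDiagram) {r : ℕ} (h : ν.colLen 0 ≤ r) : ν.rowLen r = 0 := by
  by_contra hne
  have := YoungDiagram.mem_iff_lt_colLen.1
    (YoungDiagram.mem_iff_lt_rowLen.2 (Nat.pos_of_ne_zero hne))
  omega

theorem sum_skewCells {B : Type*} [AddCommMonoid B] (lam mu : YoungDiagram) {N : ℕ}
    (hN : ∀ r, N ≤ r → lam.rowLen r ≤ mu.rowLen r) (f : ℕ → ℕ → B) :
    ∑ b ∈ skewCells lam mu, f b.1 b.2 =
      ∑ r ∈ range N, ∑ c ∈ Ico (mu.rowLen r) (lam.rowLen r), f r c := by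
  refine sum_finset_product _ _ (fun r => Ico (mu.rowLen r) (lam.rowLen r)) fun p => ?_
  rw [mem_skewCells (r := p.1) (c := p.2), mem_range, mem_Ico]
  refine ⟨fun h => ⟨?_, h⟩, And.right⟩
  by_contra hcon
  have := hN p.1 (by omega)
  omega

/-- The coefficients of a Schur function in terms of Schur polynomials. -/
theorem schur_apply (M : ℕ) (ν : YoungDiagram) (m : ℕ →₀ ℕ) (hm : ∀ x, M ≤ x → m x = 0) :
    schur ν m = (((schurPoly M (rows ν)).coeff m : ℕ) : ℚ) := by
  rw [schur, skewSchur, ← (card_tableaux M (rows ν) m (rows_antitone ν) hm).2]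
  congr 1
  have hcell : ∀ r c, (r, c) ∈ skewCells ν ⊥ ↔ c < rows ν r := fun r c => by
    rw [mem_skewCells, rowLen_bot]; simp
  have hcont : ∀ T : SkewTableau ν ⊥, T.weight = content (rows ν) T.entry := fun T => by
    rw [SkewTableau.weight, content_eq_sum_range (ν := rows ν) (N := ν.colLen 0)
      T.entry fun r hr => rowLen_eq_zero ν hr, sum_skewCells ν ⊥ (N := ν.colLen 0)
      (fun r hr => by rw [rowLen_eq_zero ν hr]; exact Nat.zero_le _)
      fun r c => Finsupp.single (T.entry r c) 1]
    simp only [rowLen_bot, rows_apply, range_eq_Ico]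
  refine Nat.card_congr
    { toFun := fun T => ⟨T.1.entry, ⟨⟨fun r c₁ c₂ h1 h2 => T.1.row_weak r c₁ c₂ h1
        ((hcell r c₁).2 (h1.trans h2)) ((hcell r c₂).2 h2), fun r₁ r₂ c h1 h2 h3 =>
        T.1.col_strict r₁ r₂ c h1 ((hcell r₁ c).2 h2) ((hcell r₂ c).2 h3), fun r c h1 =>
        T.1.zeros r c (by rw [hcell]; omega)⟩, by rw [← hcont, T.2]⟩⟩
      invFun := fun e => ⟨⟨e.1, fun r c₁ c₂ h1 _ h2 => e.2.1.row_weak r c₁ c₂ h1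
        ((hcell r c₂).1 h2), fun r₁ r₂ c h1 h2 h3 => e.2.1.col_strict r₁ r₂ c h1
        ((hcell r₁ c).1 h2) ((hcell r₂ c).1 h3), fun r c h1 => e.2.1.zeros r c
        (by rw [hcell] at h1; omega)⟩, by rw [hcont]; exact e.2.2⟩
      left_inv := fun T => rfl
      right_inv := fun e => rfl }

end MonotoneRibbon

/-! ### Ribbon tableaux as families of row contents -/

namespace MonotoneRibbon

open Finset

/-- The list of the first `l` row lengths, flagged by `D`. -/
def rowList : ℕ → (ℕ → ℕ) → (ℕ → Bool) → List (ℕ × Bool)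
  | 0, _, _ => []
  | l + 1, α, D => (α 0, D 0) :: rowList l (fun r => α (r + 1)) (fun r => D (r + 1))

theorem pos_of_mem_rowList {l : ℕ} {α : ℕ → ℕ} {D : ℕ → Bool} (h : ∀ r < l, 0 < α r)
    {q : ℕ × Bool} (hq : q ∈ rowList l α D) : 0 < q.1 := by
  induction l generalizing α D with
  | zero => simp [rowList] at hq
  | succ l ih =>
    rcases List.mem_cons.1 hq with rfl | hq
    · exact h 0 (Nat.succ_pos l)
    · exact ih (fun r hr => h (r + 1) (by omega)) hq

/-- The contents of the rows of a ribbon tableau. -/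
structure IsFamily (l : ℕ) (α : ℕ → ℕ) (D : ℕ → Bool) (P : (ℕ →₀ ℕ) → Prop) (m : ℕ →₀ ℕ)
    (u : ℕ → ℕ →₀ ℕ) : Prop where
  zero : ∀ r, l ≤ r → u r = 0
  degree : ∀ r < l, (u r).degree = α r
  sum : ∑ r ∈ range l, u r = m
  descends : ∀ r, r + 1 < l → D r = true → Descends (· < ·) (u r) (u (r + 1))
  head : 0 < l → P (u 0)

theorem finite_and_card_families (l : ℕ) (α : ℕ → ℕ) (D : ℕ → Bool) (P : (ℕ →₀ ℕ) → Prop)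
    (m : ℕ →₀ ℕ) : Finite {u // IsFamily l α D P m u} ∧ Nat.card {u // IsFamily l α D P m u} =
      sequenceCount (fun _ _ => True) (· < ·) (rowList l α D) P m := by
  induction l generalizing α D P m with
  | zero =>
    by_cases hm : m = 0
    · subst hm
      have : Unique {u // IsFamily 0 α D P 0 u} :=
        { default := ⟨fun _ => 0, by simp, by simp, by simp, by simp, by simp⟩
          uniq := fun u => Subtype.ext (funext fun r => u.2.zero r (Nat.zero_le r)) }
      exact ⟨inferInstance, by rw [Nat.card_unique]; simp [rowList, sequenceCount]⟩
    · have : IsEmpty {u // IsFamily 0 α D P m u} :=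
        ⟨fun u => hm (by rw [← u.2.sum]; simp)⟩
      exact ⟨inferInstance, by
        rw [Nat.card_eq_zero.2 (Or.inl this)]; simp [rowList, sequenceCount, hm]⟩
  | succ l ih =>
    classical
    simp only [rowList, sequenceCount]
    refine finite_and_card_of_fibers
      (Q := fun q u => IsFamily l (fun r => α (r + 1)) (fun r => D (r + 1))
        (fun w => D 0 = true → Descends (· < ·) q.1 w) q.2 u) _ _
      (fun u => ((u 0, ∑ r ∈ range l, u (r + 1)), fun r => u (r + 1)))
      (fun p r => Nat.casesOn r p.1.1 p.2) ?_ ?_ ?_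
    · intro u hu
      refine ⟨?_, ⟨fun r hr => hu.zero _ (by omega), fun r hr => hu.degree _ (by omega), rfl,
        fun r hr => hu.descends _ (by omega), fun hl => hu.descends 0 (by omega)⟩, ?_⟩
      · simp only [mem_filter, HasAntidiagonal.mem_antidiagonal, true_and]
        refine ⟨?_, hu.degree 0 (by omega), hu.head (by omega)⟩
        rw [← hu.sum, sum_range_succ', add_comm]
      · funext r
        rcases r with _ | r <;> rfl
    · rintro ⟨q₁, q₂⟩ u hq hu
      simp only [mem_filter, HasAntidiagonal.mem_antidiagonal, true_and] at hq
      obtain ⟨h1, h2, h3⟩ := hq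
      dsimp only at *
      refine ⟨⟨?_, ?_, ?_, ?_, fun _ => h3⟩, ?_⟩
      · rintro (_ | r) hr
        · omega
        · exact hu.zero r (by omega)
      · rintro (_ | r) hr
        · exact h2
        · exact hu.degree r (by omega)
      · rw [sum_range_succ', ← h1, add_comm]
        exact congrArg (q₁ + ·) hu.sum
      · rintro (_ | r) hr hD
        · exact hu.head (by omega) hD
        · exact hu.descends r (by omega) hD
      · rw [hu.sum]
        rfl
    · rintro ⟨q₁, q₂⟩ _
      exact ih _ _ _ _

/-- A weakly increasing filling of the columns `s, …, t - 1` of a row. -/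
structure IsRow (s t : ℕ) (g : ℕ → ℕ) : Prop where
  weak : ∀ c₁ c₂, c₁ < c₂ → s ≤ c₁ → c₂ < t → g c₁ ≤ g c₂
  zeros : ∀ c, ¬ (s ≤ c ∧ c < t) → g c = 0

noncomputable def rowContent (s t : ℕ) (g : ℕ → ℕ) : ℕ →₀ ℕ :=
  ∑ c ∈ Ico s t, Finsupp.single (g c) 1

theorem rowContent_degree (s t : ℕ) (g : ℕ → ℕ) : (rowContent s t g).degree = t - s := by
  simp [rowContent, map_sum]

theorem rowContent_ne_zero_iff {s t : ℕ} {g : ℕ → ℕ} {x : ℕ} :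
    rowContent s t g x ≠ 0 ↔ ∃ c, (s ≤ c ∧ c < t) ∧ g c = x := by
  simp only [rowContent, Finsupp.finsetSum_apply, Finsupp.single_apply, ne_eq,
    sum_eq_zero_iff, mem_Ico]
  push Not
  simp

/-- Built by appending the largest letter at the right end. -/
theorem exists_row (s : ℕ) (u : ℕ →₀ ℕ) :
    ∃ g, IsRow s (s + u.degree) g ∧ rowContent s (s + u.degree) g = u := by
  induction hn : u.degree generalizing u with
  | zero =>
    rw [Finsupp.degree_eq_zero_iff] at hn
    exact ⟨fun _ => 0, ⟨by simp, by simp⟩, by simp [rowContent, hn]⟩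
  | succ n ih =>
    have hne : u.support.Nonempty := by
      rw [Finsupp.support_nonempty_iff]; rintro rfl; simp at hn
    obtain ⟨x, hx⟩ : ∃ x, x = u.support.max' hne := ⟨_, rfl⟩
    have hux : u x ≠ 0 := Finsupp.mem_support_iff.1 (hx ▸ max'_mem _ _)
    have hmax : ∀ y, u y ≠ 0 → y ≤ x := fun y hy =>
      hx ▸ le_max' _ _ (Finsupp.mem_support_iff.2 hy)
    have hle : Finsupp.single x 1 ≤ u := by
      rw [Finsupp.single_le_iff]; omega
    have hsplit := tsub_add_cancel_of_le hle
    have hdeg := congrArg Finsupp.degree hsplit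
    rw [map_add, Finsupp.degree_single] at hdeg
    obtain ⟨g, hg1, hg2⟩ := ih (u - Finsupp.single x 1) (by omega)
    have hgx : ∀ c, s ≤ c → c < s + n → g c ≤ x := fun c h1 h2 => by
      refine hmax _ fun h0 => ?_
      have := rowContent_ne_zero_iff (g := g).2 ⟨c, ⟨h1, h2⟩, rfl⟩
      rw [hg2] at this
      simp [h0] at this
    refine ⟨Function.update g (s + n) x, ⟨fun c₁ c₂ h1 h2 h3 => ?_, fun c hc => ?_⟩, ?_⟩
    · rw [Function.update_of_ne (by omega)]
      by_cases h : c₂ = s + n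
      · subst h; rw [Function.update_self]; exact hgx c₁ h2 h1
      · rw [Function.update_of_ne h]; exact hg1.weak c₁ c₂ h1 h2 (by omega)
    · rw [Function.update_of_ne (by omega)]
      exact hg1.zeros c (by omega)
    · rw [rowContent, ← add_assoc, sum_Ico_succ_top (by omega), Function.update_self,
        ← hsplit, ← hg2, rowContent]
      refine congrArg (· + Finsupp.single x 1) (sum_congr rfl fun c hc => ?_)
      rw [Function.update_of_ne (by have := mem_Ico.1 hc; omega)]

/-- The entries less than x form an initial segment whose length is read off from the content, so a
row is determined by its content. -/
theorem IsRow.lt_iff {s t : ℕ} {g : ℕ → ℕ} (h : IsRow s t g) {c : ℕ} (hs : s ≤ c) (ht : c < t)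
    (x : ℕ) : g c < x ↔ c - s < ∑ y ∈ range x, rowContent s t g y := by
  have h1 : ∑ y ∈ range x, rowContent s t g y =
      ((range (t - s)).filter fun k => g (s + k) < x).card := by
    simp only [rowContent, Finsupp.finsetSum_apply, Finsupp.single_apply]
    rw [sum_comm, sum_Ico_eq_sum_range, card_filter]
    refine sum_congr rfl fun k _ => ?_
    rw [sum_ite_eq]
    simp only [mem_range]
  rw [h1, lt_card_filter_iff fun c₁ c₂ h1 h2 h3 =>
    (h.weak (s + c₁) (s + c₂) (by omega) (by omega) (by omega)).trans_lt h3,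
    Nat.add_sub_cancel' hs]
  exact ⟨fun hc => ⟨by omega, hc⟩, And.right⟩

theorem IsRow.eq {s t : ℕ} {g g' : ℕ → ℕ} (h : IsRow s t g) (h' : IsRow s t g')
    (hc : rowContent s t g = rowContent s t g') : g = g' := by
  funext c
  by_cases hct : s ≤ c ∧ c < t
  · refine eq_of_forall_gt_iff fun x => ?_
    rw [h.lt_iff hct.1 hct.2, h'.lt_iff hct.1 hct.2, hc]
  · rw [h.zeros c hct, h'.zeros c hct]

/-- The smallest letter stands at the left end and the largest at the right end; at an overlap these
are the two boxes of the common column. -/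
theorem IsRow.descends_iff {s t s' t' : ℕ} {g g' : ℕ → ℕ} (h : IsRow s t g) (h' : IsRow s' t' g')
    (hs : s < t) (hs' : s' < t') :
    Descends (· < ·) (rowContent s t g) (rowContent s' t' g') ↔ g s < g' (t' - 1) := by
  constructor
  · rintro ⟨x, y, hxy, hx, hy⟩
    obtain ⟨c, hc, rfl⟩ := rowContent_ne_zero_iff.1 hx
    obtain ⟨c', hc', rfl⟩ := rowContent_ne_zero_iff.1 hy
    have h1 : g s ≤ g c := by
      rcases eq_or_lt_of_le hc.1 with rfl | hlt
      · exact le_rfl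
      · exact h.weak s c hlt le_rfl hc.2
    have h2 : g' c' ≤ g' (t' - 1) := by
      rcases eq_or_lt_of_le (Nat.le_sub_one_of_lt hc'.2) with heq | hlt
      · rw [heq]
      · exact h'.weak c' _ hlt hc'.1 (by omega)
    exact h1.trans_lt (hxy.trans_le h2)
  · intro hlt
    exact ⟨_, _, hlt, rowContent_ne_zero_iff.2 ⟨s, ⟨le_rfl, hs⟩, rfl⟩,
      rowContent_ne_zero_iff.2 ⟨t' - 1, by omega, rfl⟩⟩

variable {α lam mu : YoungDiagram}

theorem IsRibbonWithRows.rowLen_succ_le (hR : IsRibbonWithRows α lam mu) (r : ℕ) :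
    lam.rowLen (r + 1) ≤ mu.rowLen r + 1 := by
  by_contra! hcon
  have h1 := lam.rowLen_anti r (r + 1) (Nat.le_succ r)
  have h2 := mu.rowLen_anti r (r + 1) (Nat.le_succ r)
  refine hR.no_square r (mu.rowLen r) ⟨?_, ?_, ?_, ?_⟩ <;> rw [mem_skewCells] <;> omega

/-- Two boxes of a ribbon in one column lie in consecutive rows that overlap. -/
theorem IsRibbonWithRows.same_column (hR : IsRibbonWithRows α lam mu)
    (hα : ∀ i < α.colLen 0, 2 ≤ α.rowLen i) {r₁ r₂ c : ℕ} (hr : r₁ < r₂)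
    (h1 : (r₁, c) ∈ skewCells lam mu) (h2 : (r₂, c) ∈ skewCells lam mu) :
    r₂ = r₁ + 1 ∧ c = mu.rowLen r₁ ∧ lam.rowLen (r₁ + 1) = mu.rowLen r₁ + 1 := by
  rw [mem_skewCells] at h1 h2
  have h3 := lam.rowLen_anti (r₁ + 1) r₂ hr
  have h4 := hR.rowLen_succ_le r₁
  refine ⟨?_, by omega, by omega⟩
  -- A third row in the column would squeeze row r₁ + 1 to length at most 1, and an empty row could
  -- not be straddled at all.
  by_contra hne
  have h5 := lam.rowLen_anti (r₁ + 1 + 1) r₂ (by omega)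
  have h6 := hR.rowLen_succ_le (r₁ + 1)
  have h7 := hR.rowLen_eq (r₁ + 1)
  have h8 := mu.rowLen_anti r₁ (r₁ + 1) (by omega)
  rcases lt_or_ge (r₁ + 1) (α.colLen 0) with h9 | h9
  · have := hα _ h9; omega
  · have := rowLen_eq_zero α h9; omega

/-- Whether the row `r` overlaps with the next one. -/
def overlaps (lam mu : YoungDiagram) (r : ℕ) : Bool :=
  decide (lam.rowLen (r + 1) = mu.rowLen r + 1)

theorem IsRibbonWithRows.lt_of_overlaps (hR : IsRibbonWithRows α lam mu) {r : ℕ}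
    (h : overlaps lam mu r = true) : r + 1 < α.colLen 0 := by
  by_contra hcon
  have h1 := rowLen_eq_zero α (r := r + 1) (by omega)
  have h2 := hR.rowLen_eq (r + 1)
  have h3 := mu.rowLen_anti r (r + 1) (by omega)
  rw [overlaps, decide_eq_true_eq] at h
  omega

/-- Ribbon tableaux are counted by the contents of their rows. -/
theorem skewSchur_apply (hR : IsRibbonWithRows α lam mu)
    (hα : ∀ i < α.colLen 0, 2 ≤ α.rowLen i) (m : ℕ →₀ ℕ) :
    skewSchur lam mu m = (sequenceCount (fun _ _ => True) (· < ·)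
      (rowList (α.colLen 0) α.rowLen (overlaps lam mu)) (fun _ => True) m : ℚ) := by
  rw [← (finite_and_card_families _ _ _ _ m).2, skewSchur]
  congr 1
  have hlen : ∀ r, lam.rowLen r - mu.rowLen r = α.rowLen r := fun r => by
    rw [hR.rowLen_eq]; omega
  have hwt : ∀ e : ℕ → ℕ → ℕ, ∑ b ∈ skewCells lam mu, Finsupp.single (e b.1 b.2) 1 =
      ∑ r ∈ range (α.colLen 0), rowContent (mu.rowLen r) (lam.rowLen r) (e r) := fun e =>
    sum_skewCells lam mu (fun r hr => by rw [hR.rowLen_eq, rowLen_eq_zero α hr]; omega)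
      fun r c => Finsupp.single (e r c) 1
  have hrow : ∀ (T : SkewTableau lam mu) (r : ℕ),
      IsRow (mu.rowLen r) (lam.rowLen r) (T.entry r) := fun T r =>
    ⟨fun c₁ c₂ h1 h2 h3 => T.row_weak r c₁ c₂ h1 (mem_skewCells.2 (by omega))
      (mem_skewCells.2 (by omega)), fun c hc => T.zeros r c (by rwa [mem_skewCells])⟩
  let F : {T : SkewTableau lam mu // T.weight = m} →
      {u // IsFamily (α.colLen 0) α.rowLen (overlaps lam mu) (fun _ => True) m u} := fun T =>
    ⟨fun r => rowContent (mu.rowLen r) (lam.rowLen r) (T.1.entry r), by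
      refine ⟨fun r hr => ?_, fun r _ => ?_, ?_, fun r hr hD => ?_, fun _ => trivial⟩
      · rw [← Finsupp.degree_eq_zero_iff, rowContent_degree, hlen, rowLen_eq_zero α hr]
      · rw [rowContent_degree, hlen]
      · exact (hwt _).symm.trans T.2
      · have h1 := hα r (by omega)
        have h2 := hα (r + 1) hr
        have h3 := hR.rowLen_eq r
        have h4 := hR.rowLen_eq (r + 1)
        rw [overlaps, decide_eq_true_eq] at hD
        rw [(hrow T.1 r).descends_iff (hrow T.1 (r + 1)) (by omega) (by omega),
          show lam.rowLen (r + 1) - 1 = mu.rowLen r by omega]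
        refine T.1.col_strict r (r + 1) _ (Nat.lt_succ_self r) ?_ ?_ <;> rw [mem_skewCells] <;>
          omega⟩
  refine Nat.card_eq_of_bijective F ⟨fun T T' h => ?_, fun u => ?_⟩
  · refine Subtype.ext (SkewTableau.ext (funext fun r => ?_))
    exact (hrow T.1 r).eq (hrow T'.1 r) (congrFun (congrArg Subtype.val h) r)
  · have hex : ∀ r, ∃ g, IsRow (mu.rowLen r) (lam.rowLen r) g ∧
        rowContent (mu.rowLen r) (lam.rowLen r) g = u.1 r := fun r => by
      obtain ⟨g, hg1, hg2⟩ := exists_row (mu.rowLen r) (u.1 r)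
      have hdeg : (u.1 r).degree = α.rowLen r := by
        rcases lt_or_ge r (α.colLen 0) with hr | hr
        · exact u.2.degree r hr
        · rw [u.2.zero r hr, rowLen_eq_zero α hr, map_zero]
      rw [hdeg, ← hR.rowLen_eq] at hg1 hg2
      exact ⟨g, hg1, hg2⟩
    choose e he1 he2 using hex
    have hcol : ∀ r₁ r₂ c : ℕ, r₁ < r₂ → (r₁, c) ∈ skewCells lam mu →
        (r₂, c) ∈ skewCells lam mu → e r₁ c < e r₂ c := by
      intro r₁ r₂ c hr h1 h2
      obtain ⟨rfl, rfl, h3⟩ := hR.same_column hα hr h1 h2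
      have hov : overlaps lam mu r₁ = true := by rw [overlaps, decide_eq_true_eq, h3]
      have h4 := u.2.descends r₁ (hR.lt_of_overlaps hov) hov
      rw [mem_skewCells] at h1 h2
      rw [← he2, ← he2, (he1 r₁).descends_iff (he1 _) (by omega) (by omega), h3,
        Nat.add_sub_cancel] at h4
      exact h4
    refine ⟨⟨⟨e, fun r c₁ c₂ h1 h2 h3 => ?_, hcol, fun r c hc => ?_⟩, ?_⟩, ?_⟩
    · rw [mem_skewCells] at h2 h3
      exact (he1 r).weak c₁ c₂ h1 h2.1 h3.2
    · rw [mem_skewCells] at hc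
      exact (he1 r).zeros c hc
    · rw [SkewTableau.weight, ← u.2.sum]
      exact (hwt e).trans (sum_congr rfl fun r _ => he2 r)
    · exact Subtype.ext (funext he2)

end MonotoneRibbon

/-! ### The Schur support in terms of chains of strips -/

namespace MonotoneRibbon

open Finset

theorem sequenceCount_cons_ne_zero {A : (ℕ →₀ ℕ) → (ℕ →₀ ℕ) → Prop} {R : ℕ → ℕ → Prop} {a : ℕ}
    {f : Bool} {L : List (ℕ × Bool)} {P : (ℕ →₀ ℕ) → Prop} {r : ℕ →₀ ℕ} :
    sequenceCount A R ((a, f) :: L) P r ≠ 0 ↔ ∃ u v : ℕ →₀ ℕ, u + v = r ∧ u.degree = a ∧ A v u ∧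
      P u ∧ sequenceCount A R L (fun w => f = true → Descends R u w) v ≠ 0 := by
  classical
  simp only [sequenceCount, ne_eq, sum_eq_zero_iff, mem_filter, HasAntidiagonal.mem_antidiagonal]
  push Not
  exact ⟨fun ⟨q, h, h'⟩ => ⟨q.1, q.2, h.1, h.2.1, h.2.2.1, h.2.2.2, h'⟩,
    fun ⟨u, v, h1, h2, h3, h4, h5⟩ => ⟨(u, v), ⟨h1, h2, h3, h4⟩, h5⟩⟩

theorem degree_of_sequenceCount_ne_zero {A : (ℕ →₀ ℕ) → (ℕ →₀ ℕ) → Prop} {R : ℕ → ℕ → Prop}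
    {L : List (ℕ × Bool)} {P : (ℕ →₀ ℕ) → Prop} {r : ℕ →₀ ℕ}
    (h : sequenceCount A R L P r ≠ 0) : r.degree = (L.map Prod.fst).sum := by
  induction L generalizing P r with
  | nil =>
    simp only [sequenceCount, ne_eq, ite_eq_right_iff, one_ne_zero, imp_false, not_not] at h
    simp [h]
  | cons q L ih =>
    obtain ⟨a, f⟩ := q
    obtain ⟨u, v, rfl, h1, -, -, h2⟩ := sequenceCount_cons_ne_zero.1 h
    rw [map_add, h1, ih h2]
    simp

theorem degree_content (ν : ℕ →₀ ℕ) (e : ℕ → ℕ → ℕ) : (content ν e).degree = ν.degree := by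
  simp [content, map_sum, Finsupp.degree_apply]

theorem exists_tableau_of_coeff_ne_zero {M : ℕ} {ν m : ℕ →₀ ℕ} (hν : Antitone ν)
    (hm : ∀ x, M ≤ x → m x = 0) (h : (schurPoly M ν).coeff m ≠ 0) :
    ∃ e, IsTableau ν e ∧ content ν e = m := by
  rw [← (card_tableaux M ν m hν hm).2] at h
  obtain ⟨⟨e, he⟩⟩ := (Nat.card_ne_zero.1 h).1
  exact ⟨e, he⟩

theorem IsTableau.le_entry {ν : ℕ →₀ ℕ} {e : ℕ → ℕ → ℕ} (h : IsTableau ν e) (hν : Antitone ν)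
    {r c : ℕ} (hc : c < ν r) : r ≤ e r c := by
  induction r with
  | zero => exact Nat.zero_le _
  | succ r ih =>
    have h1 := hc.trans_le (hν (Nat.le_succ r))
    exact (ih h1).trans_lt (h.col_strict r (r + 1) c (Nat.lt_succ_self r) h1 hc)

/-- Columns increase strictly, so a letter less than k can only stand in the first k rows. -/
theorem IsTableau.sum_content_le {ν : ℕ →₀ ℕ} {e : ℕ → ℕ → ℕ} (h : IsTableau ν e)
    (hν : Antitone ν) (k : ℕ) : ∑ i ∈ range k, content ν e i ≤ ∑ i ∈ range k, ν i := by
  obtain ⟨N, hN⟩ := exists_zero_of_le ν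
  have hN' : ∀ i, N + k ≤ i → ν i = 0 := fun i hi => hN i (by omega)
  rw [content_eq_sum_range e hN']
  simp only [Finsupp.finsetSum_apply, Finsupp.single_apply]
  rw [sum_comm]
  calc ∑ r ∈ range (N + k), ∑ i ∈ range k, ∑ c ∈ range (ν r), (if e r c = i then 1 else 0)
      ≤ ∑ r ∈ range (N + k), if r < k then ν r else 0 := by
        refine sum_le_sum fun r _ => ?_
        rw [sum_comm]
        simp only [sum_ite_eq, mem_range]
        split_ifs with hr
        · calc ∑ c ∈ range (ν r), (if e r c < k then 1 else 0) ≤ ∑ c ∈ range (ν r), 1 :=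
                sum_le_sum fun c _ => by split_ifs <;> omega
            _ = ν r := by simp
        · refine (sum_eq_zero fun c hc => if_neg ?_).le
          have := h.le_entry hν (mem_range.1 hc)
          omega
    _ = ∑ r ∈ range k, ν r := by
        rw [← sum_filter]
        congr 1
        ext r
        simp only [mem_filter, mem_range]
        omega

/-- A word count is a nonnegative combination of numbers of tableaux. -/
theorem sequenceCount_eq_sum (L : List (ℕ × Bool)) (hL : ∀ q ∈ L, 0 < q.1) {M : ℕ} {m : ℕ →₀ ℕ}
    (hm : ∀ x, M ≤ x → m x = 0) :
    sequenceCount (fun _ _ => True) (· < ·) L (fun _ => True) m = ∑ ν ∈ partitions m.degree,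
      sequenceCount IsStrip (· > ·) L (fun _ => True) ν * (schurPoly M ν).coeff m := by
  refine (mergeLaws_words.splits m).eq (Splits.sum _ _ fun ν => mergeLaws_strips.splits ν)
    (fun β => ?_) L hL
  have hfst : ((β.map (·, false)).map Prod.fst).sum = β.sum := by
    rw [List.map_map]; simp [Function.comp_def]
  by_cases hβ : m.degree = β.sum
  · rw [← coeff_prod_completePoly M β m hm, ← sum_sequenceCount_schurPoly, hβ,
      MvPolynomial.coeff_sum]
    exact sum_congr rfl fun ν _ => by rw [MvPolynomial.coeff_smul, smul_eq_mul]
  · rw [sum_eq_zero]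
    · by_contra hne
      exact hβ ((degree_of_sequenceCount_ne_zero hne).trans hfst)
    · intro ν hν
      rw [mem_partitions] at hν
      by_contra hne
      have := degree_of_sequenceCount_ne_zero (left_ne_zero_of_mul hne)
      exact hβ (hν.2.symm.trans (this.trans hfst))

/-! ### Linear independence of Schur functions -/

theorem rows_injective : Function.Injective rows := fun ν κ h => by
  ext ⟨r, c⟩
  rw [YoungDiagram.mem_cells, YoungDiagram.mem_cells, YoungDiagram.mem_iff_lt_rowLen,
    YoungDiagram.mem_iff_lt_rowLen, ← rows_apply, ← rows_apply, h]

theorem exists_rows_eq {ν : ℕ →₀ ℕ} (hν : Antitone ν) : ∃ κ, rows κ = ν := by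
  obtain ⟨N, hN⟩ := exists_zero_of_le ν
  have hlt : ∀ r c, c < ν r → r < N := fun r c h => by
    by_contra hcon
    rw [hN r (by omega)] at h
    omega
  refine ⟨⟨(range N ×ˢ range (ν 0)).filter fun b => b.2 < ν b.1, ?_⟩, ?_⟩
  · rintro ⟨r, c⟩ ⟨r', c'⟩ hle h
    simp only [coe_filter, mem_product, mem_range, Set.mem_ofPred_eq] at h ⊢
    have h1 : r' ≤ r := hle.1
    have h2 : c' ≤ c := hle.2
    have h3 := hν h1
    have h4 := hν (Nat.zero_le r')
    omega
  · ext r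
    refine eq_of_forall_lt_iff fun c => ?_
    rw [rows_apply, ← YoungDiagram.mem_iff_lt_rowLen]
    refine Iff.trans (show _ ↔ (r, c) ∈ (range N ×ˢ range (ν 0)).filter fun b => b.2 < ν b.1
      from Iff.rfl) ?_
    rw [mem_filter, mem_product, mem_range, mem_range]
    refine ⟨And.right, fun h => ⟨⟨hlt r c h, h.trans_le (hν (Nat.zero_le r))⟩, h⟩⟩

theorem rows_degree (ν : YoungDiagram) : (rows ν).degree = ν.card := by
  rw [degree_eq_sum_range (N := ν.colLen 0) _ fun r hr => rowLen_eq_zero ν hr,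
    YoungDiagram.card, card_eq_sum_ones]
  have h := sum_skewCells ν ⊥ (N := ν.colLen 0)
    (fun r hr => by rw [rowLen_eq_zero ν hr]; exact Nat.zero_le _) fun _ _ => 1
  rw [skewCells, YoungDiagram.cells_bot, sdiff_empty] at h
  rw [h]
  simp [rowLen_bot]

theorem schur_rows_ne_zero (ν : YoungDiagram) : schur ν (rows ν) ≠ 0 := by
  obtain ⟨M, hM⟩ := exists_zero_of_le (rows ν)
  rw [schur_apply M ν _ hM, ← (card_tableaux M _ _ (rows_antitone ν) hM).2, Nat.cast_ne_zero,
    Nat.card_ne_zero]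
  refine ⟨⟨⟨fun r c => if c < rows ν r then r else 0, ⟨?_, ?_, ?_⟩, ?_⟩⟩,
    (card_tableaux M _ _ (rows_antitone ν) hM).1⟩
  · intro r c₁ c₂ h1 h2
    rw [if_pos h2, if_pos (h1.trans h2)]
  · intro r₁ r₂ c h1 h2 h3
    rwa [if_pos h2, if_pos h3]
  · intro r c h
    exact if_neg (by omega)
  · rw [content]
    conv_rhs => rw [← Finsupp.sum_single (rows ν)]
    refine sum_congr rfl fun r _ => ?_
    rw [sum_congr rfl (g := fun _ => Finsupp.single r 1) fun c hc => by
      rw [if_pos (mem_range.1 hc)]]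
    simp

theorem sum_rows_le_of_schur_ne_zero {ν κ : YoungDiagram} (h : schur ν (rows κ) ≠ 0) (k : ℕ) :
    ∑ i ∈ range k, rows κ i ≤ ∑ i ∈ range k, rows ν i := by
  obtain ⟨M, hM⟩ := exists_zero_of_le (rows κ)
  rw [schur_apply M ν _ hM, Nat.cast_ne_zero] at h
  obtain ⟨e, he, hc⟩ := exists_tableau_of_coeff_ne_zero (rows_antitone ν) hM h
  rw [← hc]
  exact he.sum_content_le (rows_antitone ν) k

theorem toLex_rows_le {ν κ : YoungDiagram} (h : schur ν (rows κ) ≠ 0) :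
    toLex (rows κ) ≤ toLex (rows ν) := by
  by_contra! hlt
  obtain ⟨j, h1, h2⟩ := Finsupp.Lex.lt_iff.1 hlt
  simp only [ofLex_toLex] at h1 h2
  have h3 := sum_rows_le_of_schur_ne_zero h (j + 1)
  have h4 : ∑ i ∈ range j, rows ν i = ∑ i ∈ range j, rows κ i :=
    sum_congr rfl fun i hi => h1 i (mem_range.1 hi)
  rw [sum_range_succ, sum_range_succ] at h3
  omega

/-- Triangularity: the monomial with exponents `rows κ` occurs in s_κ, and it occurs in s_ν only if
ν is lexicographically at least κ. Take κ largest in the support of the relation. -/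
theorem linearIndependent_schur : LinearIndependent ℚ schur := by
  rw [linearIndependent_iff]
  intro c hc
  by_contra hne
  obtain ⟨κ, hκ, hmax⟩ := exists_max_image c.support (fun κ => toLex (rows κ))
    (Finsupp.support_nonempty_iff.2 hne)
  rw [Finsupp.linearCombination_apply] at hc
  have h1 : ∑ ν ∈ c.support, c ν * schur ν (rows κ) = 0 := by
    have h := congrFun hc (rows κ)
    rw [Finsupp.sum] at h
    exact (Finset.sum_apply (rows κ) c.support fun ν => c ν • schur ν).symm.trans h
  rw [sum_eq_single_of_mem κ hκ] at h1
  · exact (mul_ne_zero (Finsupp.mem_support_iff.1 hκ) (schur_rows_ne_zero κ)) h1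
  · intro ν hν hνκ
    by_contra hprod
    have h2 := toLex_rows_le (right_ne_zero_of_mul hprod)
    exact hνκ (rows_injective (toLex.injective (le_antisymm (hmax ν hν) h2)))

variable {α lam mu : YoungDiagram}

/-- The Schur support of a ribbon consists of the shapes of chains of horizontal strips that
descend at the overlaps. -/
theorem mem_schurSupport_iff (hR : IsRibbonWithRows α lam mu)
    (hα : ∀ i < α.colLen 0, 2 ≤ α.rowLen i) (ν : YoungDiagram) :
    ν ∈ schurSupport lam mu ↔ sequenceCount IsStrip (· > ·)
      (rowList (α.colLen 0) α.rowLen (overlaps lam mu)) (fun _ => True) (rows ν) ≠ 0 := by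
  set L := rowList (α.colLen 0) α.rowLen (overlaps lam mu) with hLdef
  have hL : ∀ q ∈ L, 0 < q.1 := fun q hq =>
    pos_of_mem_rowList (fun r hr => by have := hα r hr; omega) hq
  let S := (partitions (L.map Prod.fst).sum).preimage rows rows_injective.injOn
  let c : YoungDiagram →₀ ℚ := Finsupp.onFinset S
    (fun κ => (sequenceCount IsStrip (· > ·) L (fun _ => True) (rows κ) : ℚ)) fun κ hκ => by
      rw [mem_preimage, mem_partitions]
      exact ⟨rows_antitone κ, degree_of_sequenceCount_ne_zero (Nat.cast_ne_zero.1 hκ)⟩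
  have hc : skewSchur lam mu = c.sum fun κ a => a • schur κ := by
    funext m
    obtain ⟨M, hM⟩ := exists_zero_of_le m
    rw [skewSchur_apply hR hα m, sequenceCount_eq_sum L hL hM,
      Finsupp.onFinset_sum _ (fun κ => zero_smul ℚ (schur κ))]
    have h1 : (∑ κ ∈ S, (sequenceCount IsStrip (· > ·) L (fun _ => True) (rows κ) : ℚ) •
        schur κ) m = ∑ κ ∈ S, ((sequenceCount IsStrip (· > ·) L (fun _ => True) (rows κ) *
          (schurPoly M (rows κ)).coeff m : ℕ) : ℚ) := by
      refine (Finset.sum_apply m S _).trans (sum_congr rfl fun κ _ => ?_)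
      rw [Nat.cast_mul, ← schur_apply M κ m hM]
      rfl
    rw [h1, ← Nat.cast_sum, sum_preimage rows _ _ (fun ν =>
      sequenceCount IsStrip (· > ·) L (fun _ => True) ν * (schurPoly M ν).coeff m)]
    · congr 1
      -- In a degree different from that of the ribbon both sides vanish termwise.
      by_cases hdeg : m.degree = (L.map Prod.fst).sum
      · rw [hdeg]
      · rw [sum_eq_zero, sum_eq_zero]
        · intro ν hν
          rw [mem_partitions] at hν
          by_contra hne
          obtain ⟨e, -, he⟩ := exists_tableau_of_coeff_ne_zero hν.1 hM (right_ne_zero_of_mul hne)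
          exact hdeg (by rw [← he, degree_content, hν.2])
        · intro ν hν
          rw [mem_partitions] at hν
          by_contra hne
          exact hdeg (hν.2.symm.trans (degree_of_sequenceCount_ne_zero (left_ne_zero_of_mul hne)))
    · intro ν hν hnot
      exact absurd (exists_rows_eq (mem_partitions.1 hν).1) hnot
  constructor
  · rintro ⟨c', hc', hne⟩
    have : c' = c := by
      refine linearIndependent_schur ?_
      rw [Finsupp.linearCombination_apply, Finsupp.linearCombination_apply, ← hc, ← hc']
    rw [this] at hne
    exact Nat.cast_ne_zero.1 hne
  · exact fun h => ⟨c, hc, Nat.cast_ne_zero.2 h⟩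

end MonotoneRibbon

/-! ### The support consists of the admissible partitions -/

namespace MonotoneRibbon

open Finset

section

variable {l : ℕ} {a A p δ c : ℕ → ℕ} {D : ℕ → Bool}

theorem RibbonNumbers.shift (h : RibbonNumbers (l + 1) a A p δ c) :
    RibbonNumbers l (fun i => a (i + 1)) (fun i => A (i + 1)) (fun i => p (i + 1))
      (fun i => δ (i + 1)) (fun i => c (i + 1)) where
  anti := fun i j hij => h.anti (Nat.succ_le_succ hij)
  tail i := h.tail (i + 1)
  overlap_tail i := h.overlap_tail (i + 1)
  overlap_le i hi := by have := h.overlap_le (i + 1) (by omega); omega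
  overlap_zero i hi := h.overlap_zero (i + 1) (by omega)
  tail_ge i := by have := h.tail_ge (i + 1); omega
  tail_zero i hi := h.tail_zero (i + 1) (by omega)
  bound i := h.bound (i + 1)

/-- An admissible partition is the shape of a chain of strips that descends where it should. -/
theorem Admissible.sequenceCount_ne_zero (h : RibbonNumbers l a A p δ c)
    (hδ : ∀ r, δ r = if D r = true ∧ r + 1 < l then 1 else 0) (ha : ∀ r < l, 2 ≤ a r)
    {ν : ℕ →₀ ℕ} (hν : Admissible l a A c ν) (P : (ℕ →₀ ℕ) → Prop)
    (hP : 0 < l → ∀ y : ℕ →₀ ℕ, y.degree = a 0 → y ≤ ν →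
      (∀ k, ν k ≠ 0 → ν (k + 1) = 0 → ν k < ν 0 → ∃ j < k, y j ≠ 0) → P y) :
    sequenceCount IsStrip (· > ·) (rowList l a D) P ν ≠ 0 := by
  induction l generalizing a A p δ c D ν P with
  | zero =>
    have : ν = 0 := by ext i; exact hν.zero i (Nat.zero_le i)
    simp [rowList, sequenceCount, this]
  | succ l ih =>
    obtain ⟨κ', h1, h2, h3⟩ := exists_admissible_step h hν (ha 0 (Nat.succ_pos l))
    obtain ⟨κ, hκ⟩ : ∃ κ : ℕ →₀ ℕ, ∀ i, κ i = κ' i :=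
      ⟨Finsupp.onFinset ν.support κ' fun i hi => by
        have := (h1 i).2
        rw [Finsupp.mem_support_iff]
        omega, fun _ => rfl⟩
    obtain rfl : ⇑κ = κ' := funext hκ
    have hle : κ ≤ ν := fun i => (h1 i).2
    have hsplit : ν - κ + κ = ν := tsub_add_cancel_of_le hle
    have hA : A 0 = a 0 + A 1 := h.tail 0
    have hdν : ν.degree = A 0 := by rw [degree_eq_sum_range ν hν.zero, hν.total]
    have hdκ : κ.degree = A 1 := by rw [degree_eq_sum_range κ h2.zero, h2.total]
    have hdu : (ν - κ).degree = a 0 := by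
      have := congrArg Finsupp.degree hsplit
      rw [map_add] at this
      omega
    rw [rowList, sequenceCount_cons_ne_zero]
    refine ⟨ν - κ, κ, hsplit, hdu, ?_, ?_, ?_⟩
    · rw [isStrip_iff, hsplit]
      exact fun i => ⟨hle i, (h1 i).1⟩
    · refine hP (Nat.succ_pos l) _ hdu (fun i => Nat.sub_le _ _) fun k hk hk1 hk0 => ?_
      obtain ⟨j, hj, hlt⟩ := (h3 k hk hk1).2 hk0
      refine ⟨j, hj, ?_⟩
      rw [Finsupp.coe_tsub, Pi.sub_apply]
      omega
    · refine ih h.shift (fun r => ?_) (fun r hr => ha (r + 1) (by omega)) h2 _ ?_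
      · rw [hδ (r + 1)]
        simp
      · intro hl w hw hwκ hwgood hD
        have hδ0 : δ 0 = 1 := by rw [hδ, if_pos ⟨hD, by omega⟩]
        obtain ⟨k, hk, hk1⟩ : ∃ k, ν k ≠ 0 ∧ ν (k + 1) = 0 := by
          by_contra! hcon
          have : ∀ k, ν k ≠ 0 := by
            intro k
            induction k with
            | zero =>
              have h4 := hν.dom 1
              have h5 := ha 0 (Nat.succ_pos l)
              simp only [sum_range_one] at h4
              omega
            | succ k ihk => exact hcon k ihk
          exact this _ (hν.zero (l + 1) le_rfl)
        have hlast := (h3 k hk hk1).1 hδ0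
        have huk : (ν - κ) k ≠ 0 := by
          rw [Finsupp.coe_tsub, Pi.sub_apply]
          omega
        suffices ∃ j < k, w j ≠ 0 by
          obtain ⟨j, hj, hwj⟩ := this
          exact ⟨k, j, hj, huk, hwj⟩
        -- The removed strip has a box in the last row k of ν, so the next strip needs a box above
        -- row k. This is automatic if κ does not reach row k; otherwise k is the last row of κ, and
        -- the condition on the next strip applies once κ k < κ 0.
        by_cases hκk : κ k = 0
        · have hw0 : w ≠ 0 := by
            rintro rfl
            have := ha 1 (by omega)
            rw [map_zero] at hw
            simp only [zero_add] at hw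
            omega
          obtain ⟨y, hy⟩ := DFunLike.ne_iff.1 hw0
          refine ⟨y, ?_, hy⟩
          by_contra! hcon
          have h4 := h2.anti hcon
          have h5 := hwκ y
          have h6 : w y ≠ 0 := hy
          omega
        · refine hwgood k hκk (Nat.le_zero.1 (hk1 ▸ hle (k + 1))) ?_
          -- A single row is impossible: it would have A 0 boxes, more than c 0 = A 0 - p 0, since δ
          -- 0 = 1.
          rcases k with _ | k
          · have h4 := hν.sum_range_eq hk1
            have h5 := hν.cap 0
            have h6 := h.bound 0
            have h7 := h.overlap_tail 0
            simp only [zero_add, sum_range_one] at h4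
            omega
          · have h4 := (h1 k).1
            have h5 := h2.anti (Nat.zero_le k)
            omega

/-- The shape of a chain of strips that descends where it should is admissible. -/
theorem admissible_of_sequenceCount_ne_zero (h : RibbonNumbers l a A p δ c)
    (hδ : ∀ r, δ r = if D r = true ∧ r + 1 < l then 1 else 0) {ν : ℕ →₀ ℕ}
    {P : (ℕ →₀ ℕ) → Prop}
    (hν : sequenceCount IsStrip (· > ·) (rowList l a D) P ν ≠ 0) : Admissible l a A c ν := by
  induction l generalizing a A p δ c D ν P with
  | zero =>
    have h0 : ν = 0 := by
      by_contra hne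
      simp [rowList, sequenceCount, hne] at hν
    subst h0
    have h1 := h.tail_zero
    have h2 := h.tail
    refine ⟨fun _ _ _ => le_rfl, fun _ _ => rfl, by simp [h1], fun r => ?_, fun i => Nat.zero_le _⟩
    refine sum_le_sum fun j _ => ?_
    have := h1 j (Nat.zero_le j)
    have := h2 j
    omega
  | succ l ih =>
    rw [rowList, sequenceCount_cons_ne_zero] at hν
    obtain ⟨u, v, huv, hu, hA, -, hv⟩ := hν
    rw [isStrip_iff, huv] at hA
    have hvA := ih h.shift (fun r => by rw [hδ (r + 1)]; simp) hv
    have hz : ∀ i, l + 1 ≤ i → ν i = 0 := fun i hi => by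
      have h1 := (hA (i - 1)).2
      have h2 := hvA.zero (i - 1) (by omega)
      rw [Nat.sub_add_cancel (by omega)] at h1
      omega
    have hdν : ν.degree = A 0 := by
      rw [← huv, map_add, hu, degree_eq_sum_range v hvA.zero, hvA.total]
      exact (h.tail 0).symm
    have hν0 : ν 0 = u 0 + v 0 := by rw [← huv]; rfl
    refine ⟨hA.antitone_right, hz, by rw [← degree_eq_sum_range ν hz, hdν], fun r => ?_,
      fun i => ?_⟩
    · rcases r with _ | r
      · simp
      · have h1 := hvA.dom r
        have h2 : ∑ j ∈ range (r + l + 1), ν j = a 0 + ∑ j ∈ range (r + l), v j := by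
          rw [← degree_eq_sum_range ν fun i hi => hz i (by omega),
            ← degree_eq_sum_range v fun i hi => hvA.zero i (by omega), ← huv, map_add, hu]
        -- Interlacing bounds the rows of ν after row r by the rows of v from r on, so the first r +
        -- 1 rows of ν hold at least a 0 more than the first r rows of v.
        have h3 : ∑ j ∈ Ico r (r + l), ν (j + 1) ≤ ∑ j ∈ Ico r (r + l), v j :=
          sum_le_sum fun j _ => (hA j).2
        rw [sum_range_succ', ← sum_range_add_sum_Ico _ (show r ≤ r + l by omega),
          ← sum_range_add_sum_Ico v (show r ≤ r + l by omega)] at h2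
        rw [sum_range_succ', sum_range_succ' ν]
        omega
    · rcases i with _ | i
      · have h1 : v 0 ≤ c 1 := hvA.cap 0
        have h2 : A 0 = a 0 + A 1 := h.tail 0
        have h3 : p 0 = δ 0 + p 1 := h.overlap_tail 0
        have h4 := h.bound 0
        have h5 := h.bound 1
        have h6 := hδ 0
        suffices u 0 + δ 0 ≤ a 0 by omega
        have hu0 : u 0 ≤ a 0 := hu ▸ Finsupp.le_degree 0 u
        split_ifs at h6 with hD
        · obtain ⟨l', rfl⟩ : ∃ l', l = l' + 1 := ⟨l - 1, by omega⟩
          rw [rowList, sequenceCount_cons_ne_zero] at hv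
          obtain ⟨w, v', -, -, -, hdesc, -⟩ := hv
          obtain ⟨x, y, hxy, hx, -⟩ := hdesc hD.1
          -- A descent needs a box of u in a row x > y ≥ 0, so at most a 0 - 1 boxes of u lie in row
          -- 0.
          have h7 : u 0 + u x ≤ u.degree := by
            obtain ⟨N, hN⟩ := exists_zero_of_le u
            have hxN : x < N := by
              by_contra hcon
              exact hx (hN x (by omega))
            rw [degree_eq_sum_range u hN, ← sum_pair (f := u) (show (0 : ℕ) ≠ x by omega)]
            refine sum_le_sum_of_subset fun z hz => ?_
            simp only [mem_insert, mem_singleton] at hz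
            rw [mem_range]
            omega
          omega
        · omega
      · exact (hA i).2.trans (hvA.cap i)

end

variable {α lam mu : YoungDiagram}

theorem IsRibbonWithRows.mem_of_overlaps (hR : IsRibbonWithRows α lam mu)
    (hα : ∀ i < α.colLen 0, 2 ≤ α.rowLen i) {d : ℕ} (h : overlaps lam mu d = true) :
    (d, mu.rowLen d) ∈ skewCells lam mu ∧ (d + 1, mu.rowLen d) ∈ skewCells lam mu := by
  have h0 := hR.lt_of_overlaps h
  have h1 := hα d (by omega)
  have h2 := hR.rowLen_eq d
  have h3 := mu.rowLen_anti d (d + 1) (by omega)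
  rw [overlaps, decide_eq_true_eq] at h
  rw [mem_skewCells, mem_skewCells]
  omega

/-- A column of length two belongs to exactly one overlapping pair of rows d, d + 1, and it is the
column in which row d starts. -/
theorem IsRibbonWithRows.overlap_eq (hR : IsRibbonWithRows α lam mu)
    (hα : ∀ i < α.colLen 0, 2 ≤ α.rowLen i) (i : ℕ) :
    overlap lam mu i = ∑ d ∈ Ico i (α.colLen 0),
      if overlaps lam mu d = true ∧ d + 1 < α.colLen 0 then 1 else 0 := by
  rw [← card_filter, overlap]
  symm
  refine card_bij (fun d _ => mu.rowLen d) ?_ ?_ ?_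
  · intro d hd
    rw [mem_filter, mem_Ico] at hd
    obtain ⟨h1, h2⟩ := hR.mem_of_overlaps hα hd.2.1
    have h3 := lam.rowLen_anti 0 d (Nat.zero_le d)
    rw [mem_filter, mem_range]
    refine ⟨(mem_skewCells.1 h1).2.trans_le h3,
      card_eq_two.2 ⟨(d, mu.rowLen d), (d + 1, mu.rowLen d), by simp, ?_⟩⟩
    ext ⟨r, c⟩
    simp only [mem_filter, mem_insert, mem_singleton, Prod.mk.injEq]
    constructor
    · rintro ⟨h4, h5, rfl⟩
      rcases lt_trichotomy r d with hlt | rfl | hlt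
      · have h6 := (hR.same_column hα (show r < d + 1 by omega) h4 h2).1
        omega
      · exact Or.inl ⟨rfl, rfl⟩
      · exact Or.inr ⟨(hR.same_column hα hlt h1 h4).1, rfl⟩
    · rintro (⟨rfl, rfl⟩ | ⟨rfl, rfl⟩)
      · exact ⟨h1, hd.1.1, rfl⟩
      · exact ⟨h2, by omega, rfl⟩
  · have key : ∀ d d', overlaps lam mu d = true → overlaps lam mu d' = true →
        mu.rowLen d = mu.rowLen d' → ¬ d < d' := by
      intro d d' hd hd' heq hlt
      obtain ⟨h1, -⟩ := hR.mem_of_overlaps hα hd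
      obtain ⟨-, h2⟩ := hR.mem_of_overlaps hα hd'
      rw [← heq] at h2
      have := (hR.same_column hα (show d < d' + 1 by omega) h1 h2).1
      omega
    intro d hd d' hd' heq
    rw [mem_filter] at hd hd'
    have h1 := key d d' hd.2.1 hd'.2.1 heq
    have h2 := key d' d hd'.2.1 hd.2.1 heq.symm
    omega
  · intro c hc
    rw [mem_filter] at hc
    obtain ⟨⟨r, c₁⟩, ⟨r', c₂⟩, hne, heq⟩ := card_eq_two.1 hc.2
    have h1 : (r, c₁) ∈ ({(r, c₁), (r', c₂)} : Finset (ℕ × ℕ)) := by simp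
    have h2 : (r', c₂) ∈ ({(r, c₁), (r', c₂)} : Finset (ℕ × ℕ)) := by simp
    rw [← heq, mem_filter] at h1 h2
    obtain ⟨h1, h3, rfl⟩ := h1
    obtain ⟨h2, h4, rfl⟩ := h2
    have key : ∀ r r', r < r' → i ≤ r → (r, c₂) ∈ skewCells lam mu → (r', c₂) ∈ skewCells lam mu →
        ∃ d, ∃ _ : d ∈ (Ico i (α.colLen 0)).filter
          (fun d => overlaps lam mu d = true ∧ d + 1 < α.colLen 0), mu.rowLen d = c₂ := by
      intro r r' hlt hi h1 h2
      obtain ⟨-, h5, h6⟩ := hR.same_column hα hlt h1 h2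
      have hov : overlaps lam mu r = true := by rw [overlaps, decide_eq_true_eq, h6]
      have h7 := hR.lt_of_overlaps hov
      exact ⟨r, by rw [mem_filter, mem_Ico]; exact ⟨⟨hi, by omega⟩, hov, h7⟩, h5.symm⟩
    rcases lt_trichotomy r r' with hlt | rfl | hlt
    · exact key r r' hlt h3 h1 h2
    · exact absurd rfl hne
    · exact key r' r hlt h4 h2 h1

theorem IsRibbonWithRows.ribbonNumbers (hR : IsRibbonWithRows α lam mu)
    (hα : ∀ i < α.colLen 0, 2 ≤ α.rowLen i) :
    RibbonNumbers (α.colLen 0) α.rowLen (fun i => ∑ q ∈ Ico i (α.colLen 0), α.rowLen q)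
      (overlap lam mu)
      (fun d => if overlaps lam mu d = true ∧ d + 1 < α.colLen 0 then 1 else 0)
      (fun i => ∑ q ∈ Ico i (α.colLen 0), α.rowLen q - overlap lam mu i) where
  anti _ _ h := α.rowLen_anti _ _ h
  tail i := by
    rcases lt_or_ge i (α.colLen 0) with h | h
    · exact sum_eq_sum_Ico_succ_bot h _
    · rw [Ico_eq_empty (by omega), Ico_eq_empty (by omega), rowLen_eq_zero α h]; simp
  overlap_tail i := by
    rw [hR.overlap_eq hα, hR.overlap_eq hα]
    rcases lt_or_ge i (α.colLen 0) with h | h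
    · exact sum_eq_sum_Ico_succ_bot h _
    · rw [Ico_eq_empty (by omega), Ico_eq_empty (by omega), if_neg (by omega)]; simp
  overlap_le i hi := by
    rw [hR.overlap_eq hα, ← card_filter]
    have : (Ico i (α.colLen 0)).filter
        (fun d => overlaps lam mu d = true ∧ d + 1 < α.colLen 0) ⊆ Ico i (α.colLen 0 - 1) := by
      intro d hd
      rw [mem_filter, mem_Ico] at hd
      rw [mem_Ico]
      omega
    have := card_le_card this
    rw [Nat.card_Ico] at this
    omega
  overlap_zero i hi := by rw [hR.overlap_eq hα, Ico_eq_empty (by omega), sum_empty]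
  tail_ge i := by
    have : ∑ q ∈ Ico i (α.colLen 0), 2 ≤ ∑ q ∈ Ico i (α.colLen 0), α.rowLen q :=
      sum_le_sum fun q hq => hα q (mem_Ico.1 hq).2
    rw [sum_const, Nat.card_Ico, smul_eq_mul] at this
    omega
  tail_zero i hi := by rw [Ico_eq_empty (by omega), sum_empty]
  bound i := by
    refine Nat.sub_add_cancel ?_
    rw [hR.overlap_eq hα]
    refine sum_le_sum fun d hd => ?_
    have := hα d (mem_Ico.1 hd).2
    split_ifs <;> omega

/-- The Schur support of a monotone ribbon. -/
theorem mem_schurSupport_iff_admissible (hR : IsRibbonWithRows α lam mu)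
    (hα : ∀ i < α.colLen 0, 2 ≤ α.rowLen i) (ν : YoungDiagram) :
    ν ∈ schurSupport lam mu ↔
      Admissible (α.colLen 0) α.rowLen (fun i => ∑ q ∈ Ico i (α.colLen 0), α.rowLen q)
        (fun i => ∑ q ∈ Ico i (α.colLen 0), α.rowLen q - overlap lam mu i) ν.rowLen := by
  rw [mem_schurSupport_iff hR hα]
  exact ⟨fun h => admissible_of_sequenceCount_ne_zero (hR.ribbonNumbers hα) (fun _ => rfl) h,
    fun h => Admissible.sequenceCount_ne_zero (hR.ribbonNumbers hα) (fun _ => rfl) hα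
      (ν := rows ν) h _ fun _ _ _ _ _ => trivial⟩

end MonotoneRibbon

/-! ### Witness vectors and witness partitions -/

namespace MonotoneRibbon

open Finset

section

variable {l : ℕ} {a A p δ c ν : ℕ → ℕ}

theorem RibbonNumbers.admissible (h : RibbonNumbers l a A p δ c) (hanti : Antitone ν)
    (hle : ∀ r, ∑ j ∈ range r, ν j ≤ A 0)
    (hdom : ∀ r, ∑ j ∈ range r, a j ≤ ∑ j ∈ range r, ν j) (hcap : ∀ i, ν i ≤ c i) :
    Admissible l a A c ν := by
  have h1 := h.sum_add_tail l
  have h2 := h.tail_zero l le_rfl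
  have h3 := hdom l
  have h4 := hle l
  refine ⟨hanti, fun i hi => ?_, by omega, hdom, hcap⟩
  have h5 := hle (l + 1)
  rw [sum_range_succ] at h5
  have h6 := hanti hi
  omega

/-- If row `i` of `ν` exceeds its bound, then the `i`-th witness vector is small. -/
theorem RibbonNumbers.sum_lt_overlap (h : RibbonNumbers l a A p δ c) (hanti : Antitone ν)
    (hle : ∀ r, ∑ j ∈ range r, ν j ≤ A 0)
    (hdom : ∀ r, ∑ j ∈ range r, a j ≤ ∑ j ∈ range r, ν j) {i : ℕ} (hi : c i < ν i) :
    ∑ j ∈ range i, (c i + 1 - a j) < p i := by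
  -- Each summand is max (a j) (c i + 1). While a k ≥ c i + 1 the earlier maxima are also just a j
  -- and dominance suffices; afterwards ν k ≥ ν i ≥ c i + 1 is added row by row.
  have key : ∀ k ≤ i, ∑ j ∈ range k, (a j + (c i + 1 - a j)) ≤ ∑ j ∈ range k, ν j := by
    intro k
    induction k with
    | zero => simp
    | succ k ih =>
      intro hk
      rcases le_total (c i + 1) (a k) with hak | hak
      · refine le_trans (le_of_eq (sum_congr rfl fun j hj => ?_)) (hdom (k + 1))
        have := h.anti (Nat.lt_succ_iff.1 (mem_range.1 hj))
        omega
      · rw [sum_range_succ, sum_range_succ]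
        have h1 := ih (by omega)
        have h2 := hanti (show k ≤ i by omega)
        omega
  have h1 := key i le_rfl
  have h2 := hle (i + 1)
  have h3 := h.sum_add_tail i
  have h4 := h.bound i
  rw [sum_range_succ] at h2
  rw [sum_add_distrib] at h1
  omega

/-- The rows of the `i`-th witness partition. -/
def witnessRow (a : ℕ → ℕ) (i ρ q j : ℕ) : ℕ :=
  if j < i then a j + (ρ - a j) else if j = i then ρ else if j = i + 1 then q else 0

theorem witnessRow_antitone (ha : Antitone a) {i ρ q : ℕ} (hq : q ≤ ρ) :
    Antitone (witnessRow a i ρ q) := by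
  intro x y hxy
  have := ha hxy
  unfold witnessRow
  split_ifs <;> omega

theorem sum_range_witnessRow (i ρ q : ℕ) {k : ℕ} (hk : k ≤ i) :
    ∑ j ∈ range k, witnessRow a i ρ q j = ∑ j ∈ range k, (a j + (ρ - a j)) :=
  sum_congr rfl fun _ hj => if_pos ((mem_range.1 hj).trans_le hk)

theorem sum_range_succ_witnessRow (i ρ q : ℕ) :
    ∑ j ∈ range (i + 1), witnessRow a i ρ q j =
      ∑ j ∈ range i, a j + ∑ j ∈ range i, (ρ - a j) + ρ := by
  rw [sum_range_succ, sum_range_witnessRow i ρ q le_rfl, sum_add_distrib]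
  simp [witnessRow]

theorem sum_range_add_two_witnessRow (i ρ q : ℕ) :
    ∑ j ∈ range (i + 2), witnessRow a i ρ q j =
      ∑ j ∈ range i, a j + ∑ j ∈ range i, (ρ - a j) + ρ + q := by
  rw [sum_range_succ, sum_range_succ_witnessRow]
  simp [witnessRow]

theorem RibbonNumbers.overlap_le_add (h : RibbonNumbers l a A p δ c) (i : ℕ) (hi : i < l) :
    p i < c i + 1 := by
  have h1 := h.bound i
  have h2 := h.tail_ge i
  have h3 := h.overlap_le i hi
  omega

theorem RibbonNumbers.sum_witnessRow (h : RibbonNumbers l a A p δ c) {i g : ℕ}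
    (hg : ∑ j ∈ range i, (c i + 1 - a j) = g) (hgp : g < p i) :
    ∑ j ∈ range (i + 2), witnessRow a i (c i + 1) (p i - 1 - g) j = A 0 := by
  rw [sum_range_add_two_witnessRow, hg]
  have h1 := h.bound i
  have h2 := h.sum_add_tail i
  omega

/-- The first i rows only grow, row i has c i + 1 ≥ a i because A (i + 1) ≥ p i, and with the last
row the full size is reached. -/
theorem RibbonNumbers.sum_le_sum_witnessRow (h : RibbonNumbers l a A p δ c) {i g : ℕ}
    (hi : i < l) (hg : ∑ j ∈ range i, (c i + 1 - a j) = g) (hgp : g < p i) (r : ℕ) :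
    ∑ j ∈ range r, a j ≤ ∑ j ∈ range r, witnessRow a i (c i + 1) (p i - 1 - g) j := by
  rcases le_or_gt r i with hr | hr
  · rw [sum_range_witnessRow _ _ _ hr]
    exact sum_le_sum fun j _ => Nat.le_add_right _ _
  rcases eq_or_lt_of_le (Nat.succ_le_of_lt hr) with rfl | hr
  · rw [Nat.succ_eq_add_one, sum_range_succ_witnessRow, sum_range_succ]
    have h1 := h.bound i
    have h2 := h.tail i
    have h3 := h.tail_ge (i + 1)
    have h4 := h.overlap_le i hi
    omega
  · have h1 := h.sum_add_tail r
    calc ∑ j ∈ range r, a j ≤ A 0 := by omega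
      _ = ∑ j ∈ range (i + 2), witnessRow a i (c i + 1) (p i - 1 - g) j :=
        (h.sum_witnessRow hg hgp).symm
      _ ≤ _ := sum_le_sum_of_subset (range_mono hr)

theorem RibbonNumbers.overlap_zero_le (h : RibbonNumbers l a A p δ c) (hδ : ∀ i, δ i ≤ 1) (i : ℕ) :
    p 0 ≤ p i + i := by
  induction i with
  | zero => exact le_rfl
  | succ i ih =>
    have h1 := h.overlap_tail i
    have h2 := hδ i
    omega

/-- The row is max (a 0) (c i + 1). The first term fits because A 1 ≥ p 0. The second does because
the first i ≥ 1 rows bring at least 2 * i boxes but at most i overlaps. -/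
theorem RibbonNumbers.witnessRow_zero_le (h : RibbonNumbers l a A p δ c) (hδ : ∀ i, δ i ≤ 1)
    (ha : ∀ r < l, 2 ≤ a r) {i : ℕ} (h0 : 1 ≤ i) (hi : i < l) (q : ℕ) :
    witnessRow a i (c i + 1) q 0 ≤ A 0 - p 0 := by
  have h1 := h.bound i
  have h2 := h.tail 0
  have h3 : 2 * l ≤ A (0 + 1) + 2 * 1 := h.tail_ge 1
  have h4 := h.overlap_le 0 (by omega)
  have h5 := h.overlap_zero_le hδ i
  have h6 := h.sum_add_tail i
  have h7 : ∑ j ∈ range i, 2 ≤ ∑ j ∈ range i, a j :=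
    sum_le_sum fun j hj => ha j ((mem_range.1 hj).trans hi)
  rw [sum_const, card_range, smul_eq_mul] at h7
  rw [witnessRow, if_pos (Nat.lt_of_succ_le h0)]
  omega

end

theorem card_eq_sum_rowLen (ν : YoungDiagram) {k : ℕ} (h : ν.colLen 0 ≤ k) :
    ν.card = ∑ i ∈ range k, ν.rowLen i := by
  rw [← rows_degree]
  exact degree_eq_sum_range _ fun i hi => rowLen_eq_zero ν (h.trans hi)

theorem sum_rowLen_le_card (ν : YoungDiagram) (k : ℕ) :
    ∑ i ∈ range k, ν.rowLen i ≤ ν.card := by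
  rw [card_eq_sum_rowLen ν (le_max_left (ν.colLen 0) k)]
  exact sum_le_sum_of_subset (range_mono (le_max_right _ _))

theorem rowLen_decreasingRearrangement (k : ℕ) {f : ℕ → ℕ} (hf : ∀ i j, i < j → j < k → f j ≤ f i)
    (i : ℕ) :
    (decreasingRearrangement ((Multiset.range k).map f)).rowLen i = if i < k then f i else 0 := by
  have hsort : ((Multiset.range k).map f).sort (· ≥ ·) = (List.range k).map f := by
    refine List.Perm.eq_of_sortedGE (Multiset.pairwise_sort _ _).sortedGE ?_ ?_
    · refine List.Pairwise.sortedGE ?_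
      rw [List.pairwise_map]
      refine List.Pairwise.imp_of_mem ?_ List.pairwise_lt_range
      intro x y _ hy hxy
      exact hf x y hxy (List.mem_range.1 hy)
    · rw [← Multiset.coe_eq_coe, Multiset.sort_eq]
      rfl
  refine eq_of_forall_lt_iff fun d => ?_
  rw [← YoungDiagram.mem_iff_lt_rowLen, decreasingRearrangement, YoungDiagram.mem_ofRowLens]
  simp only [hsort, List.length_map, List.length_range, List.getElem_map, List.getElem_range]
  split_ifs with hi <;> simp [hi]

theorem card_decreasingRearrangement (k : ℕ) {f : ℕ → ℕ}
    (hf : ∀ i j, i < j → j < k → f j ≤ f i) :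
    (decreasingRearrangement ((Multiset.range k).map f)).card = ∑ i ∈ range k, f i := by
  set ν := decreasingRearrangement ((Multiset.range k).map f)
  rw [card_eq_sum_rowLen ν (le_max_left (ν.colLen 0) k),
    ← sum_range_add_sum_Ico _ (le_max_right (ν.colLen 0) k), sum_eq_zero (s := Ico _ _), add_zero]
  · refine sum_congr rfl fun i hi => ?_
    rw [rowLen_decreasingRearrangement k hf, if_pos (mem_range.1 hi)]
  · intro i hi
    rw [rowLen_decreasingRearrangement k hf, if_neg (by rw [mem_Ico] at hi; omega)]

/-- The partitions dominated by a partition with at most two parts. -/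
theorem dominated_pair_iff (ν : YoungDiagram) {s q : ℕ} (hqs : q ≤ s) :
    Dominated ν (decreasingRearrangement {s, q}) ↔ ν.card = s + q ∧ ν.rowLen 0 ≤ s := by
  have hpair : ({s, q} : Multiset ℕ) = (Multiset.range 2).map fun i => if i = 0 then s else q := by
    simp only [Multiset.range_succ, Multiset.range_zero, Multiset.map_cons, Multiset.map_zero,
      if_true, one_ne_zero, if_false]
    exact Multiset.pair_comm s q
  have hf : ∀ i j, i < j → j < 2 → (if j = 0 then s else q) ≤ if i = 0 then s else q := by
    intro i j _ _
    split_ifs <;> omega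
  have hrow := rowLen_decreasingRearrangement 2 hf
  have hcard := card_decreasingRearrangement 2 hf
  rw [← hpair] at hrow hcard
  simp only [sum_range_succ, sum_range_zero, zero_add, if_true, one_ne_zero, if_false] at hcard
  rw [Dominated, hcard]
  refine and_congr_right fun hν => ⟨fun h => ?_, fun h k => ?_⟩
  · have := h 1
    rw [sum_range_one, sum_range_one, hrow] at this
    simpa using this
  · rcases k with _ | _ | k
    · simp
    · rw [zero_add, sum_range_one, sum_range_one, hrow]
      simpa using h
    · refine (sum_rowLen_le_card ν _).trans ?_
      rw [hν, sum_range_succ', sum_range_succ']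
      simp only [hrow]
      simp
      omega

variable {α lam mu : YoungDiagram}

theorem lt_overlapLength_iff {l : ℕ} {a A p δ c : ℕ → ℕ} (h : RibbonNumbers l a A p δ c)
    (hl : α.colLen 0 = l) (i : ℕ) :
    i < overlapLength α p ↔ i < l ∧ p i ≠ 0 := by
  rw [overlapLength, hl]
  refine lt_card_filter_iff (fun i j hij _ hj => ?_) i
  have : Antitone p := antitone_nat_of_succ_le fun n => by have := h.overlap_tail n; omega
  have := this hij.le
  omega

end MonotoneRibbon

/-! ### The theorem -/

open MonotoneRibbon

theorem theorem1p3 (α lam mu : YoungDiagram)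
    (hα : ∀ i < α.colLen 0, 2 ≤ α.rowLen i)
    (hR : MonotoneRibbon.IsRibbonWithRows α lam mu)
    (p : ℕ → ℕ) (hp : ∀ i, p i = MonotoneRibbon.overlap lam mu i) :
    (MonotoneRibbon.schurSupport lam mu ⊂
        MonotoneRibbon.dominanceInterval α
          (MonotoneRibbon.decreasingRearrangement {α.card - p 0, p 0}) ↔
      2 ≤ MonotoneRibbon.overlapLength α p ∧
        ∃ i, 1 ≤ i ∧ i ≤ MonotoneRibbon.overlapLength α p - 1 ∧
          MonotoneRibbon.witnessSize α p i ≤ p i - 1) ∧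
    ∀ i, 1 ≤ i → i ≤ MonotoneRibbon.overlapLength α p - 1 →
      MonotoneRibbon.witnessSize α p i ≤ p i - 1 →
        (∀ j < i, MonotoneRibbon.rho α p i ≤ α.rowLen j + MonotoneRibbon.witness α p i j) ∧
        p i - 1 - MonotoneRibbon.witnessSize α p i ≤ MonotoneRibbon.rho α p i ∧
        (MonotoneRibbon.witnessPartition α p i).card = α.card ∧
        MonotoneRibbon.witnessPartition α p i ∈
          MonotoneRibbon.dominanceInterval α
            (MonotoneRibbon.decreasingRearrangement {α.card - p 0, p 0}) ∧
        MonotoneRibbon.witnessPartition α p i ∉ MonotoneRibbon.schurSupport lam mu := by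
  obtain rfl : p = overlap lam mu := funext hp
  have h := hR.ribbonNumbers hα
  have hsupp := mem_schurSupport_iff_admissible hR hα
  have hA0 : ∑ q ∈ Finset.Ico 0 (α.colLen 0), α.rowLen q = α.card := by
    rw [Nat.Ico_zero_eq_range, card_eq_sum_rowLen α le_rfl]
  have hrho : ∀ i, rho α (overlap lam mu) i =
      ∑ q ∈ Finset.Ico i (α.colLen 0), α.rowLen q - overlap lam mu i + 1 := by
    intro i
    have := h.bound i
    rw [rho]
    omega
  have hδ : ∀ d, (if overlaps lam mu d = true ∧ d + 1 < α.colLen 0 then 1 else 0) ≤ 1 := fun d => by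
    split_ifs <;> omega
  generalize hδ' : (fun d => if overlaps lam mu d = true ∧ d + 1 < α.colLen 0 then 1 else 0) = δ at h
  simp only [funext_iff] at hδ'
  simp only [hδ'] at hδ
  generalize hA : (fun i => ∑ q ∈ Finset.Ico i (α.colLen 0), α.rowLen q) = A at h hsupp
  simp only [funext_iff] at hA
  simp only [hA] at h hsupp hA0 hrho
  generalize overlap lam mu = p at h hsupp hrho
  generalize hc : (fun i => A i - p i) = c at h hsupp
  simp only [funext_iff] at hc
  simp only [hc] at hrho
  -- So the upper end of the interval has first row |α| - p 0 = c 0, and being dominated by it only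
  -- bounds the first row.
  have h0 : p 0 ≤ α.card - p 0 := by
    have h1 := h.tail_ge 0
    rcases Nat.eq_zero_or_pos (α.colLen 0) with h2 | h2
    · have := h.overlap_zero 0 (by omega)
      omega
    · have := h.overlap_le 0 h2
      omega
  have hn : p 0 ≤ α.card := by omega
  have hint : ∀ ν, ν ∈ dominanceInterval α (decreasingRearrangement {α.card - p 0, p 0}) ↔
      ν.card = α.card ∧ (∀ k, ∑ i ∈ Finset.range k, α.rowLen i ≤ ∑ i ∈ Finset.range k, ν.rowLen i) ∧
        ν.rowLen 0 ≤ c 0 := by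
    intro ν
    rw [dominanceInterval, Set.mem_ofPred_eq, dominated_pair_iff ν h0, Dominated,
      Nat.sub_add_cancel hn, ← hc 0, hA0]
    constructor
    · rintro ⟨⟨h1, h2⟩, -, h3⟩
      exact ⟨h1.symm, h2, h3⟩
    · rintro ⟨h1, h2, h3⟩
      exact ⟨⟨h1.symm, h2⟩, h1, h3⟩
  have hLP := lt_overlapLength_iff (α := α) h rfl
  have hsub : schurSupport lam mu ⊆
      dominanceInterval α (decreasingRearrangement {α.card - p 0, p 0}) := by
    intro ν hν
    have hν' := (hsupp ν).1 hν
    refine (hint ν).2 ⟨?_, hν'.dom, hν'.cap 0⟩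
    refine le_antisymm ?_ ?_
    · rw [card_eq_sum_rowLen ν le_rfl, ← hA0]
      exact hν'.sum_range_le _
    · rw [← hA0, ← hν'.total]
      exact sum_rowLen_le_card ν _
  have hwit : ∀ i, 1 ≤ i → i ≤ overlapLength α p - 1 → witnessSize α p i ≤ p i - 1 →
        (∀ j < i, rho α p i ≤ α.rowLen j + witness α p i j) ∧
        p i - 1 - witnessSize α p i ≤ rho α p i ∧
        (witnessPartition α p i).card = α.card ∧
        witnessPartition α p i ∈
          dominanceInterval α (decreasingRearrangement {α.card - p 0, p 0}) ∧
        witnessPartition α p i ∉ schurSupport lam mu := by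
    intro i hi1 hi hg
    obtain ⟨hil, hpi⟩ := (hLP i).1 (by omega)
    -- Since p i ≠ 0, the subtraction in p i - 1 is not truncated and the inequality becomes strict.
    have hgp : witnessSize α p i < p i := by omega
    have hgs : ∑ j ∈ Finset.range i, (c i + 1 - α.rowLen j) = witnessSize α p i := by
      simp only [witnessSize, witness, hrho]
    have hq : p i - 1 - witnessSize α p i ≤ c i + 1 := by
      have := h.overlap_le_add i hil
      omega
    have hanti := witnessRow_antitone h.anti (i := i) hq
    have hW : witnessPartition α p i = decreasingRearrangement ((Multiset.range (i + 2)).map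
        (witnessRow α.rowLen i (c i + 1) (p i - 1 - witnessSize α p i))) := by
      have h1 : (Multiset.range i).map (fun j => α.rowLen j + witness α p i j) =
          (Multiset.range i).map
            (witnessRow α.rowLen i (c i + 1) (p i - 1 - witnessSize α p i)) := by
        refine Multiset.map_congr rfl fun j hj => ?_
        rw [witnessRow, if_pos (Multiset.mem_range.1 hj), witness, hrho]
      rw [witnessPartition, h1, Multiset.range_succ, Multiset.range_succ, Multiset.map_cons,
        Multiset.map_cons, hrho]
      congr 1
      simp only [witnessRow, lt_irrefl, if_false, if_true, show ¬ i + 1 < i by omega,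
        show i + 1 ≠ i by omega]
      rw [add_comm, Multiset.insert_eq_cons, Multiset.cons_add, Multiset.singleton_add,
        Multiset.cons_swap]
    have hrow := rowLen_decreasingRearrangement (i + 2) fun x y hxy _ => hanti hxy.le
    have hcard := card_decreasingRearrangement (i + 2) fun x y hxy _ => hanti hxy.le
    rw [← hW] at hrow hcard
    replace hrow : (witnessPartition α p i).rowLen =
        witnessRow α.rowLen i (c i + 1) (p i - 1 - witnessSize α p i) := by
      funext j
      rw [hrow, witnessRow]
      split_ifs <;> first | rfl | omega
    rw [h.sum_witnessRow hgs hgp, hA0] at hcard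
    refine ⟨fun j _ => ?_, hrho i ▸ hq, hcard, (hint _).2 ⟨hcard, fun k => ?_, ?_⟩, fun hmem => ?_⟩
    · rw [witness]; omega
    · rw [hrow]
      exact h.sum_le_sum_witnessRow hil hgs hgp k
    · rw [hrow, ← hc 0]
      exact h.witnessRow_zero_le hδ hα hi1 hil _
    -- Row i of the witness partition is c i + 1, one more than the bound allows.
    · have h1 := ((hsupp _).1 hmem).cap i
      rw [hrow, witnessRow, if_neg (lt_irrefl i), if_pos rfl] at h1
      omega
  refine ⟨⟨fun hlt => ?_, fun ⟨_, i, hi1, hi, hg⟩ => ?_⟩, hwit⟩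
  · obtain ⟨ν, hν, hν'⟩ := Set.exists_of_ssubset hlt
    obtain ⟨h1, h2, h3⟩ := (hint ν).1 hν
    have hanti : Antitone ν.rowLen := fun _ _ hxy => ν.rowLen_anti _ _ hxy
    have hle : ∀ r, ∑ j ∈ Finset.range r, ν.rowLen j ≤ A 0 := fun r => by
      rw [hA0, ← h1]
      exact sum_rowLen_le_card ν r
    -- A member of the interval outside the support can only fail one of the bounds, and not the one
    -- for row 0.
    obtain ⟨i, hi⟩ : ∃ i, c i < ν.rowLen i := by
      by_contra! hcap
      exact hν' ((hsupp ν).2 (h.admissible hanti hle h2 hcap))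
    have h4 := h.sum_lt_overlap hanti hle h2 hi
    have h5 : i ≠ 0 := by rintro rfl; omega
    have h6 : i < α.colLen 0 := by
      by_contra hcon
      have := h.overlap_zero i (by omega)
      omega
    have h7 := (hLP i).2 ⟨h6, by omega⟩
    refine ⟨by omega, i, by omega, by omega, ?_⟩
    simp only [witnessSize, witness, hrho]
    omega
  · obtain ⟨-, -, -, h1, h2⟩ := hwit i hi1 hi hg
    exact Set.ssubset_iff_subset_ne.2 ⟨hsub, fun heq => h2 (heq ▸ h1)⟩
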